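/- **Setting.** Let $d\ge 1$, and let $\mathcal D\subset\mathbb R^d$ be closed, bounded and convex with Euclidean diameter $D$. Let $\rho:\mathbb R\to[-1,1]$ be an *admissible transfer function* with constants $p\ge 1$, $r>0$, $c_\rho>0$: $\rho$ is differentiable, $\rho(-x)=-\rho(x)$, $\rho(0)=0$, $\operatorname{sign}\rho(x)=\operatorname{sign}x$ for $x\ne 0$, and $\rho'(x)\ge c_\rho\,p\,|x|^{p-1}$ for $|x|<r$. Let $\alpha,\beta,\varepsilon>0$, $\tilde c=\tfrac1{20}$ and $$B=\frac{2c_\rho p}{\max\{1,\alpha+\beta\}}\Big(\frac{\alpha^2}{4\beta}\Big)^{p}\frac{\tilde c^{\,2p-1}}{d^{(2p+1)/2}},\qquad k_\varepsilon=\max\Big\{0,\Big\lceil\log_{4/3}\frac{\beta D^2}{2\varepsilon}\Big\rceil\Big\},\qquad D_1=D,\quad D_{k+1}=\sqrt{3/4}\,D_k,$$ $$\eta_k=B\,D_k^{2p+1},\qquad \gamma_k=\frac{\tilde c\,\alpha D_k}{2\beta\sqrt d},\qquad t_k=\Big\lceil\frac{1}{2B^2(D_k^2)^{2p}}\Big\rceil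 .$$ Let $\mathcal D^+=\{x:\operatorname{dist}(x,\mathcal D)\le\gamma_1\}$ be the set of points that may be queried. Let $f$ be a real function that is differentiable at every point of $\mathcal D^+$ and is $\alpha$-strongly convex and $\beta$-smooth on $\mathcal D^+$, i.e. for all $x,y\in\mathcal D^+$, $$\nabla f(y)^\top(x-y)+\tfrac\alpha2\|x-y\|^2\le f(x)-f(y)\le\nabla f(y)^\top(x-y)+\tfrac\beta2\|x-y\|^2 .$$ Assume that $f$ attains its minimum over $\mathcal D$ at a point $w^*$ in the interior of $\mathcal D$, and that $|f(w+v)-f(w-v)|\le r$ for all $w\in\mathcal D$ and $\|v\|\le\gamma_1$ (every duel the algorithm may play lies in the range where the lower bound on $\rho'$ is available). **Algorithms.** *Relative-Gradient-Descent*$(w,\eta,\gamma,T)$ starts at $x_1=w\in\mathcal D$. For $t=1,\dots,T$ it draws $u_t$ uniformly from the unit sphere, independently of the past, asks one pairwise comparison of $x_t+\gamma u_t$ and $x_t-\gamma u_t$, receives $o_t\in\{\pm1\}$ whose conditional mean given the past and $u_t$ is $\rho\big(f(x_t+\gamma u_t)-f(x_t-\gamma u_t)\big)$, and lets $x_{t+1}$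 be the Euclidean projection of $x_t-\eta\,o_tu_t$ onto $\mathcal D$. It returns $x_{T+1}$. *Epoch-RGD*$(\varepsilon)$ starts at an arbitrary $w_1\in\mathcal D$, sets $w_{k+1}=$ Relative-Gradient-Descent$(w_k,\eta_k,\gamma_k,t_k)$ for $k=1,\dots,k_\varepsilon$, and returns $w_{k_\varepsilon+1}$. **Theorem (Epoch-RGD, smooth strongly convex case).** In this setting: 1. $\mathbb E\|w_{k+1}-w^*\|^2\le\tfrac34\max\{\mathbb E\|w_k-w^*\|^2,\;D_k^2\}$ for $1\le k\le k_\varepsilon$, and $\mathbb E\|w_k-w^*\|^2\le D_k^2=(3/4)^{k-1}D^2$ for $1\le k\le k_\varepsilon+1$; 2. $\mathbb E[f(w_{k_\varepsilon+1})]-f(w^*)\le\varepsilon$; 3. the total number of pairwise comparisons satisfies $\sum_{k=1}^{k_\varepsilon}t_k\le\dfrac{C}{B^2\varepsilon^{2p}}$ with a constant $C$ that depends only on $\beta$ and $p$; in particular it is $O(\varepsilon^{-2p})$. -/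

import Mathlib

open MeasureTheory ProbabilityTheory

/-- An admissible transfer function `ρ : ℝ → [-1,1]` with parameters `p, r, c`
(so `x ↦ c · sign x · |x|^p` is its `p`-th order proxy). -/
structure IsAdmissibleTransfer (ρ : ℝ → ℝ) (p r c : ℝ) : Prop where
  mem_Icc : ∀ x, ρ x ∈ Set.Icc (-1 : ℝ) 1
  differentiable : Differentiable ℝ ρ
  antisymm : ∀ x, ρ (-x) = -ρ x
  map_zero : ρ 0 = 0
  sign_eq : ∀ x, x ≠ 0 → SignType.sign (ρ x) = SignType.sign x
  one_le_p : 1 ≤ p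
  r_pos : 0 < r
  c_pos : 0 < c
  le_deriv : ∀ x ∈ Set.Ioo (-r) r, c * p * |x| ^ (p - 1) ≤ deriv ρ x

/-- First-order `α`-strong convexity of a differentiable `f` on the set `S`. -/
def IsStronglyConvexOn {d : ℕ} (S : Set (EuclideanSpace ℝ (Fin d))) (α : ℝ)
    (f : EuclideanSpace ℝ (Fin d) → ℝ) : Prop :=
  ∀ x ∈ S, ∀ y ∈ S,
    inner ℝ (gradient f y) (x - y) + α / 2 * ‖x - y‖ ^ 2 ≤ f x - f y

/-- `β`-smoothness of a differentiable `f` on the set `S`. -/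
def IsSmoothOn {d : ℕ} (S : Set (EuclideanSpace ℝ (Fin d))) (β : ℝ)
    (f : EuclideanSpace ℝ (Fin d) → ℝ) : Prop :=
  ∀ x ∈ S, ∀ y ∈ S,
    f x - f y ≤ inner ℝ (gradient f y) (x - y) + β / 2 * ‖x - y‖ ^ 2

/-- `y` is a Euclidean projection of `z` onto `S`, i.e. `y ∈ argmin_{w ∈ S} ‖w - z‖`. -/
def IsProjection {d : ℕ} (S : Set (EuclideanSpace ℝ (Fin d)))
    (z y : EuclideanSpace ℝ (Fin d)) : Prop :=
  y ∈ S ∧ ∀ w ∈ S, ‖y - z‖ ≤ ‖w - z‖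

/-- The uniform probability distribution on the unit sphere of `ℝ^d`: the normalized
surface measure, viewed as a measure on `ℝ^d`. -/
noncomputable def unifSphere (d : ℕ) : Measure (EuclideanSpace ℝ (Fin d)) :=
  Measure.map Subtype.val
    (((volume : Measure (EuclideanSpace ℝ (Fin d))).toSphere Set.univ)⁻¹ •
      (volume : Measure (EuclideanSpace ℝ (Fin d))).toSphere)

/-- The history before round `t`: the sigma-algebra generated by
`x_s, u_s, o_s` for `s < t`, and by `x_t`. -/
abbrev rgdHistory {Ω : Type*} {d : ℕ} (x u : ℕ → Ω → EuclideanSpace ℝ (Fin d))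
    (o : ℕ → Ω → ℝ) (t : ℕ) : MeasurableSpace Ω :=
  MeasurableSpace.comap (x t) inferInstance ⊔
    ⨆ s : Fin t, (MeasurableSpace.comap (x s) inferInstance ⊔
      MeasurableSpace.comap (u s) inferInstance ⊔
      MeasurableSpace.comap (o s) inferInstance)

/-- A run of Relative-Gradient-Descent with learning rate `η`, perturbation `γ` and query
budget `T` on the domain `S` (rounds are numbered `0, …, T - 1`): `x` are the iterates, `u` the
sampled directions, `o` the answers to the duels `(x_t + γ u_t, x_t - γ u_t)`.
Exactly one duel is played per round, so the run uses `T` pairwise comparisons. As `o_t = ±1`,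
the condition on its conditional mean says `o_t ∼ Ber±(ρ(f(x_t + γ u_t) - f(x_t - γ u_t)))`
given the history and `u_t`. -/
structure IsRGDRun {Ω : Type*} [MeasurableSpace Ω] (P : Measure Ω) {d : ℕ}
    (S : Set (EuclideanSpace ℝ (Fin d))) (f : EuclideanSpace ℝ (Fin d) → ℝ) (ρ : ℝ → ℝ)
    (η γ : ℝ) (T : ℕ) (x u : ℕ → Ω → EuclideanSpace ℝ (Fin d)) (o : ℕ → Ω → ℝ) : Prop where
  init_mem : ∀ ω, x 0 ω ∈ S
  measurable_init : Measurable (x 0)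
  measurable_dir : ∀ t < T, Measurable (u t)
  measurable_answer : ∀ t < T, Measurable (o t)
  dir_law : ∀ t < T, P.map (u t) = unifSphere d
  dir_indep : ∀ t < T,
    Indep (MeasurableSpace.comap (u t) inferInstance) (rgdHistory x u o t) P
  answer_sign : ∀ t < T, ∀ᵐ ω ∂P, o t ω = 1 ∨ o t ω = -1
  answer_mean : ∀ t < T,
    P[o t | rgdHistory x u o t ⊔ MeasurableSpace.comap (u t) inferInstance] =ᵐ[P]
      fun ω => ρ (f (x t ω + γ • u t ω) - f (x t ω - γ • u t ω))
  update : ∀ t < T, ∀ ω, IsProjection S (x t ω - η • (o t ω • u t ω)) (x (t + 1) ω)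

/-- The constant `c̃ = 1/20`. -/
noncomputable def cTilde : ℝ := 1 / 20

/-- The constant `B`. -/
noncomputable def epochB (α β c p : ℝ) (d : ℕ) : ℝ :=
  2 * c * p / max 1 (α + β) *
    ((α ^ 2 / (4 * β)) ^ p * (cTilde ^ (2 * p - 1) / (d : ℝ) ^ ((2 * p + 1) / 2)))

/-- The radii `D_1 = D`, `D_{k+1} = √(3/4) D_k`, numbered from `0`. -/
noncomputable def epochRadius (D : ℝ) : ℕ → ℝ
  | 0 => D
  | k + 1 => √(3 / 4) * epochRadius D k

/-- Learning rate `η_k = B D_k^{2p+1}`. -/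
noncomputable def epochEta (α β c p : ℝ) (d : ℕ) (D : ℝ) (k : ℕ) : ℝ :=
  epochB α β c p d * epochRadius D k ^ (2 * p + 1)

/-- Perturbation `γ_k = c̃ α D_k / (2 β √d)`. -/
noncomputable def epochGamma (α β : ℝ) (d : ℕ) (D : ℝ) (k : ℕ) : ℝ :=
  cTilde * α * epochRadius D k / (2 * β * √(d : ℝ))

/-- Query budget `t_k = 1 / (2 B² (D_k²)^{2p})`, rounded up to an integer. -/
noncomputable def epochBudget (α β c p : ℝ) (d : ℕ) (D : ℝ) (k : ℕ) : ℕ :=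
  ⌈1 / (2 * epochB α β c p d ^ 2 * (epochRadius D k ^ 2) ^ (2 * p))⌉₊

/-- Number of epochs `k_ε = ⌈log_{4/3} (β D² / (2 ε))⌉` (no epoch if this is negative). -/
noncomputable def epochCount (β D ε : ℝ) : ℕ :=
  ⌈Real.logb (4 / 3) (β * D ^ 2 / (2 * ε))⌉₊

/-- Total number of pairwise comparisons used by Epoch-RGD. -/
noncomputable def epochQueries (α β c p : ℝ) (d : ℕ) (D ε : ℝ) : ℕ :=
  ∑ k ∈ Finset.range (epochCount β D ε), epochBudget α β c p d D k

/-- A run of Epoch-RGD from `w₁ ∈ S`. Epochs are numbered `0, …, k_ε - 1`; `w k` is the point at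
which epoch `k` starts and `w k_ε` is the point that is returned. Epoch `k` is a run
of Relative-Gradient-Descent started at `w k`; its iterates, directions and answers are
`x k`, `u k`, `o k`. -/
structure IsEpochRGDRun {Ω : Type*} [MeasurableSpace Ω] (P : Measure Ω) {d : ℕ}
    (S : Set (EuclideanSpace ℝ (Fin d))) (f : EuclideanSpace ℝ (Fin d) → ℝ) (ρ : ℝ → ℝ)
    (α β c p D ε : ℝ) (w₁ : EuclideanSpace ℝ (Fin d))
    (w : ℕ → Ω → EuclideanSpace ℝ (Fin d))
    (x u : ℕ → ℕ → Ω → EuclideanSpace ℝ (Fin d)) (o : ℕ → ℕ → Ω → ℝ) : Prop where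
  init_mem : w₁ ∈ S
  init : ∀ ω, w 0 ω = w₁
  start : ∀ k < epochCount β D ε, x k 0 = w k
  run : ∀ k < epochCount β D ε,
    IsRGDRun P S f ρ (epochEta α β c p d D k) (epochGamma α β d D k)
      (epochBudget α β c p d D k) (x k) (u k) (o k)
  next : ∀ k < epochCount β D ε, w (k + 1) = x k (epochBudget α β c p d D k)

/-- A differentiable function whose derivative dominates that of `c x ^ p` on `[0, r)` grows
at least as fast as `c x ^ p` on `[0, r]`. -/
theorem IsAdmissibleTransfer.rpow_sub_le {ρ : ℝ → ℝ} {p r c : ℝ}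
    (hρ : IsAdmissibleTransfer ρ p r c) {x y : ℝ} (hx : 0 ≤ x) (hxy : x ≤ y) (hy : y ≤ r) :
    c * (y ^ p - x ^ p) ≤ ρ y - ρ x := by
  have hp := hρ.one_le_p
  have hmono : MonotoneOn (fun t => ρ t - c * t ^ p) (Set.Icc 0 r) := by
    apply monotoneOn_of_deriv_nonneg (convex_Icc 0 r)
    · refine (hρ.differentiable.continuous.sub (continuous_const.mul ?_)).continuousOn
      exact Real.continuous_rpow_const (by linarith)
    · intro t ht
      rw [interior_Icc] at ht
      exact ((hρ.differentiable t).sub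
        ((Real.differentiableAt_rpow_const_of_ne p ht.1.ne').const_mul c)).differentiableWithinAt
    · intro t ht
      rw [interior_Icc] at ht
      have h1 : HasDerivAt (fun t : ℝ => ρ t - c * t ^ p)
          (deriv ρ t - c * (p * t ^ (p - 1))) t :=
        (hρ.differentiable t).hasDerivAt.sub
          ((Real.hasDerivAt_rpow_const (Or.inl ht.1.ne')).const_mul c)
      rw [h1.deriv]
      have h2 := hρ.le_deriv t ⟨by linarith [ht.1, ht.2], ht.2⟩
      rw [abs_of_pos ht.1] at h2
      linarith
  have := hmono ⟨hx, hxy.trans hy⟩ ⟨hx.trans hxy, hy⟩ hxy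
  simp only at this
  linarith

theorem IsAdmissibleTransfer.rpow_le {ρ : ℝ → ℝ} {p r c : ℝ}
    (hρ : IsAdmissibleTransfer ρ p r c) {y : ℝ} (hy0 : 0 ≤ y) (hy : y ≤ r) :
    c * y ^ p ≤ ρ y := by
  have h := hρ.rpow_sub_le le_rfl hy0 hy
  rw [hρ.map_zero, Real.zero_rpow (by linarith [hρ.one_le_p])] at h
  linarith

/-- Quantitative monotonicity of a transfer function on `[-r, r]`. -/
theorem IsAdmissibleTransfer.rpow_le_sub {ρ : ℝ → ℝ} {p r c : ℝ}
    (hρ : IsAdmissibleTransfer ρ p r c) {x y : ℝ} (hx : |x| ≤ r) (hy : |y| ≤ r) (hxy : x ≤ y) :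
    c * 2 ^ (1 - p) * (y - x) ^ p ≤ ρ y - ρ x := by
  have hp := hρ.one_le_p
  have hc := hρ.c_pos
  have h2 : (2 : ℝ) ^ (1 - p) ≤ 1 := Real.rpow_le_one_of_one_le_of_nonpos (by norm_num) (by linarith)
  have same : ∀ s t : ℝ, 0 ≤ s → s ≤ t → t ≤ r →
      c * 2 ^ (1 - p) * (t - s) ^ p ≤ ρ t - ρ s := by
    intro s t hs hst ht
    have h1 := hρ.rpow_sub_le hs hst ht
    have h3 := Real.add_rpow_le_rpow_add (sub_nonneg.2 hst) hs hp
    rw [sub_add_cancel] at h3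
    have h4 : 0 ≤ (t - s) ^ p := Real.rpow_nonneg (sub_nonneg.2 hst) p
    calc c * 2 ^ (1 - p) * (t - s) ^ p ≤ c * (t - s) ^ p := by
          gcongr
          nlinarith
      _ ≤ c * (t ^ p - s ^ p) := by
          gcongr
          linarith
      _ ≤ _ := h1
  rw [abs_le] at hx hy
  rcases le_total 0 x with h0 | h0
  · exact same x y h0 hxy hy.2
  rcases le_total y 0 with h1 | h1
  · have := same (-y) (-x) (by linarith) (by linarith) (by linarith)
    rw [hρ.antisymm, hρ.antisymm] at this
    have e : -x - -y = y - x := by ring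
    rw [e] at this
    linarith
  · have hyp := hρ.rpow_le h1 hy.2
    have hxp := hρ.rpow_le (neg_nonneg.2 h0) (by linarith)
    rw [hρ.antisymm] at hxp
    have h3 : (y - x) ^ p ≤ 2 ^ (p - 1) * (y ^ p + (-x) ^ p) := by
      have := NNReal.rpow_add_le_mul_rpow_add_rpow ⟨y, h1⟩ ⟨-x, neg_nonneg.2 h0⟩ hp
      rw [sub_eq_add_neg]
      exact_mod_cast this
    have h4 : (2 : ℝ) ^ (1 - p) * 2 ^ (p - 1) = 1 := by
      rw [← Real.rpow_add (by norm_num)]; simp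
    calc c * 2 ^ (1 - p) * (y - x) ^ p
        ≤ c * 2 ^ (1 - p) * (2 ^ (p - 1) * (y ^ p + (-x) ^ p)) := by
          gcongr
      _ = c * (2 ^ (1 - p) * 2 ^ (p - 1)) * (y ^ p + (-x) ^ p) := by ring
      _ = c * (y ^ p + (-x) ^ p) := by rw [h4, mul_one]
      _ ≤ _ := by linarith

theorem IsAdmissibleTransfer.abs_le_one {ρ : ℝ → ℝ} {p r c : ℝ}
    (hρ : IsAdmissibleTransfer ρ p r c) (x : ℝ) : |ρ x| ≤ 1 := abs_le.2 (hρ.mem_Icc x)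

open scoped Pointwise in
/-- The surface measure is invariant under linear isometries. -/
theorem toSphere_preimage_linearIsometryEquiv {E : Type*} [NormedAddCommGroup E]
    [InnerProductSpace ℝ E] [MeasurableSpace E] [BorelSpace E] [FiniteDimensional ℝ E]
    (L : E ≃ₗᵢ[ℝ] E) {s : Set E} (hs : MeasurableSet s) :
    (volume : Measure E).toSphere (Subtype.val ⁻¹' (L ⁻¹' s)) =
      (volume : Measure E).toSphere (Subtype.val ⁻¹' s) := by
  rw [Measure.toSphere_apply' _ (measurable_subtype_coe (L.continuous.measurable hs)),
    Measure.toSphere_apply' _ (measurable_subtype_coe hs)]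
  congr 1
  have key : (Set.Ioo (0 : ℝ) 1 • ((↑) '' (Subtype.val ⁻¹' (L ⁻¹' s) : Set (Metric.sphere (0 : E) 1)))
      : Set E) = L ⁻¹' (Set.Ioo (0 : ℝ) 1 •
        ((↑) '' (Subtype.val ⁻¹' s : Set (Metric.sphere (0 : E) 1)))) := by
    ext z
    simp only [Set.mem_smul, Set.mem_image, Set.mem_preimage, Subtype.exists,
      mem_sphere_iff_norm, sub_zero]
    constructor
    · rintro ⟨t, ht, _, ⟨y, hy, hys, rfl⟩, rfl⟩
      exact ⟨t, ht, L y, ⟨L y, by simpa using hy, hys, rfl⟩, by simp⟩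
    · rintro ⟨t, ht, _, ⟨y, hy, hys, rfl⟩, h⟩
      refine ⟨t, ht, L.symm y, ⟨L.symm y, by simpa using hy, by simpa using hys, rfl⟩, ?_⟩
      apply L.injective
      rw [← h]
      simp
  rw [key]
  exact (L.measurePreserving).measure_preimage_equiv (f := L.toMeasurableEquiv) _

theorem measurePreserving_unifSphere {d : ℕ}
    (L : EuclideanSpace ℝ (Fin d) ≃ₗᵢ[ℝ] EuclideanSpace ℝ (Fin d)) :
    MeasurePreserving L (unifSphere d) (unifSphere d) := by
  refine ⟨L.continuous.measurable, ?_⟩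
  ext s hs
  rw [Measure.map_apply L.continuous.measurable hs, unifSphere,
    Measure.map_apply measurable_subtype_coe (L.continuous.measurable hs),
    Measure.map_apply measurable_subtype_coe hs, Measure.smul_apply, Measure.smul_apply,
    toSphere_preimage_linearIsometryEquiv L hs]

theorem isProbabilityMeasure_unifSphere {d : ℕ} (hd : 1 ≤ d) :
    IsProbabilityMeasure (unifSphere d) := by
  have : Nontrivial (EuclideanSpace ℝ (Fin d)) := by
    have : Nonempty (Fin d) := ⟨⟨0, hd⟩⟩
    infer_instance
  constructor
  rw [unifSphere, Measure.map_apply measurable_subtype_coe .univ, Set.preimage_univ,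
    Measure.smul_apply, smul_eq_mul]
  refine ENNReal.inv_mul_cancel ?_ (measure_ne_top _ _)
  rw [Ne, Measure.measure_univ_eq_zero]
  exact Measure.toSphere_ne_zero _

theorem ae_norm_eq_one_unifSphere (d : ℕ) : ∀ᵐ u ∂(unifSphere d), ‖u‖ = 1 := by
  rw [unifSphere, ae_map_iff measurable_subtype_coe.aemeasurable
    (measurableSet_eq_fun measurable_norm measurable_const)]
  exact Filter.Eventually.of_forall fun u => norm_eq_of_mem_sphere u

/-- A bounded measurable function on the sphere is integrable for the uniform distribution. -/
theorem integrable_unifSphere {d : ℕ} (hd : 1 ≤ d) {F : EuclideanSpace ℝ (Fin d) → ℝ}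
    (hF : Measurable F) {C : ℝ} (hC : ∀ u, ‖u‖ = 1 → |F u| ≤ C) :
    Integrable F (unifSphere d) := by
  have := isProbabilityMeasure_unifSphere hd
  refine Integrable.of_bound hF.aestronglyMeasurable C ?_
  filter_upwards [ae_norm_eq_one_unifSphere d] with u hu using hC u hu

theorem integral_inner_sq_unifSphere {d : ℕ} (hd : 1 ≤ d) {e : EuclideanSpace ℝ (Fin d)}
    (he : ‖e‖ = 1) : ∫ u, (inner ℝ u e) ^ 2 ∂(unifSphere d) = 1 / d := by
  have := isProbabilityMeasure_unifSphere hd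
  let b := EuclideanSpace.basisFun (Fin d) ℝ
  have hsame : ∀ i, ∫ u, (inner ℝ u (b i)) ^ 2 ∂(unifSphere d) =
      ∫ u, (inner ℝ u e) ^ 2 ∂(unifSphere d) := by
    intro i
    have hr : (ℝ ∙ (b i - e))ᗮ.reflection (b i) = e :=
      Submodule.reflection_sub (by rw [b.norm_eq_one, he])
    have hmp := measurePreserving_unifSphere ((ℝ ∙ (b i - e))ᗮ.reflection)
    rw [← hmp.integral_comp ((ℝ ∙ (b i - e))ᗮ.reflection).toHomeomorph.measurableEmbedding
      (fun u => (inner ℝ u e) ^ 2)]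
    refine integral_congr_ae (Filter.Eventually.of_forall fun u => ?_)
    simp only
    rw [← LinearIsometryEquiv.inner_map_map ((ℝ ∙ (b i - e))ᗮ.reflection) u (b i), hr]
  have hsum : ∑ i, ∫ u, (inner ℝ u (b i)) ^ 2 ∂(unifSphere d) = 1 := by
    rw [← integral_finsetSum]
    · rw [integral_congr_ae (g := fun _ => (1 : ℝ))]
      · simp
      · filter_upwards [ae_norm_eq_one_unifSphere d] with u hu
        have := b.sum_sq_norm_inner_left u
        simp only [Real.norm_eq_abs, sq_abs] at this
        rw [this, hu, one_pow]
    · intro i _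
      refine integrable_unifSphere hd (by fun_prop) (C := 1) fun u hu => ?_
      have := abs_real_inner_le_norm u (b i)
      rw [hu, b.norm_eq_one, one_mul] at this
      rw [abs_pow]
      exact pow_le_one₀ (abs_nonneg _) this
  simp only [hsame, Finset.sum_const, Finset.card_univ, Fintype.card_fin, nsmul_eq_mul] at hsum
  have hd0 : (d : ℝ) ≠ 0 := by positivity
  field_simp
  linarith

theorem rpow_le_integral_inner_rpow_unifSphere {d : ℕ} (hd : 1 ≤ d)
    {e : EuclideanSpace ℝ (Fin d)} (he : ‖e‖ = 1) {p : ℝ} (hp : 1 ≤ p) :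
    (1 / d : ℝ) ^ ((p + 1) / 2) ≤ ∫ u, |inner ℝ u e| ^ (p + 1) ∂(unifSphere d) := by
  have := isProbabilityMeasure_unifSphere hd
  have hle : ∀ u : EuclideanSpace ℝ (Fin d), ‖u‖ = 1 → |inner ℝ u e| ≤ 1 := fun u hu => by
    have := abs_real_inner_le_norm u e
    rwa [hu, he, one_mul] at this
  have hconv := convexOn_rpow (p := (p + 1) / 2) (by linarith)
  have hpow : ∀ u : EuclideanSpace ℝ (Fin d),
      ((inner ℝ u e) ^ 2) ^ ((p + 1) / 2) = |inner ℝ u e| ^ (p + 1) := by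
    intro u
    rw [← sq_abs, ← Real.rpow_natCast, ← Real.rpow_mul (abs_nonneg _)]
    congr 1
    push_cast
    ring
  have h := hconv.map_integral_le (μ := unifSphere d) (f := fun u => (inner ℝ u e) ^ 2)
    (Real.continuous_rpow_const (by linarith)).continuousOn isClosed_Ici
    (Filter.Eventually.of_forall fun u => sq_nonneg (inner ℝ u e)) ?_ ?_
  · rw [integral_inner_sq_unifSphere hd he] at h
    simpa only [hpow] using h
  · refine integrable_unifSphere hd (by fun_prop) (C := 1) fun u hu => ?_
    rw [abs_pow]
    exact pow_le_one₀ (abs_nonneg _) (hle u hu)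
  · refine integrable_unifSphere hd ?_ (C := 1) fun u hu => ?_
    · exact (Real.continuous_rpow_const (by linarith)).measurable.comp (by fun_prop)
    · simp only [Function.comp, hpow]
      rw [abs_of_nonneg (Real.rpow_nonneg (abs_nonneg _) _)]
      exact Real.rpow_le_one (abs_nonneg _) (hle u hu) (by linarith)

section FirstOrder

variable {d : ℕ} {A : Set (EuclideanSpace ℝ (Fin d))} {α β : ℝ}
  {f : EuclideanSpace ℝ (Fin d) → ℝ}

theorem two_mul_inner_gradient_le (hsc : IsStronglyConvexOn A α f) (hsm : IsSmoothOn A β f)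
    {y z : EuclideanSpace ℝ (Fin d)} (hy : y ∈ A) (hp : y + z ∈ A) (hm : y - z ∈ A) :
    2 * inner ℝ (gradient f y) z - (β - α) / 2 * ‖z‖ ^ 2 ≤ f (y + z) - f (y - z) := by
  have h1 := hsc _ hp _ hy
  have h2 := hsm _ hm _ hy
  rw [add_sub_cancel_left] at h1
  rw [sub_sub_cancel_left, inner_neg_right, norm_neg] at h2
  linarith

theorem mul_norm_sq_le_inner_gradient (hsc : IsStronglyConvexOn A α f)
    {w y : EuclideanSpace ℝ (Fin d)} (hw : w ∈ A) (hgrad : gradient f w = 0) (hy : y ∈ A) :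
    α * ‖y - w‖ ^ 2 ≤ inner ℝ (gradient f y) (y - w) := by
  have h1 := hsc _ hy _ hw
  have h2 := hsc _ hw _ hy
  rw [hgrad, inner_zero_left] at h1
  rw [← neg_sub y w, inner_neg_right, norm_neg] at h2
  linarith

theorem inner_gradient_sub_le (hsm : IsSmoothOn A β f) {y z : EuclideanSpace ℝ (Fin d)}
    (hy : y ∈ A) (hz : z ∈ A) :
    inner ℝ (gradient f y - gradient f z) (y - z) ≤ β * ‖y - z‖ ^ 2 := by
  have h1 := hsm _ hy _ hz
  have h2 := hsm _ hz _ hy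
  rw [← neg_sub y z, inner_neg_right, norm_neg] at h2
  rw [inner_sub_left]
  linarith

theorem le_inner_gradient_add_gradient (hsc : IsStronglyConvexOn A α f) (hsm : IsSmoothOn A β f)
    {w x q : EuclideanSpace ℝ (Fin d)} (hw : w ∈ A) (hgrad : gradient f w = 0)
    (hp : x + q ∈ A) (hm : x - q ∈ A) :
    2 * α * ‖x - w‖ ^ 2 - 2 * (β - α) * ‖q‖ ^ 2 ≤
      inner ℝ (gradient f (x + q) + gradient f (x - q)) (x - w) := by
  have h1 := mul_norm_sq_le_inner_gradient hsc hw hgrad hp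
  have h2 := mul_norm_sq_le_inner_gradient hsc hw hgrad hm
  have h3 := inner_gradient_sub_le hsm hp hm
  have e1 : x + q - w = (x - w) + q := by abel
  have e2 : x - q - w = (x - w) - q := by abel
  have e3 : x + q - (x - q) = (2 : ℝ) • q := by rw [two_smul]; abel
  have hpar := parallelogram_law_with_norm ℝ (x - w) q
  rw [e1, inner_add_right] at h1
  rw [e2, inner_sub_right] at h2
  rw [e3, norm_smul, inner_smul_right, inner_sub_left, Real.norm_ofNat] at h3
  rw [inner_add_left]
  linear_combination h1 + h2 + h3 / 2 - α * hpar

/-- The difference of the duel outcomes at a direction and at its mirror image in the hyperplane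
orthogonal to `x - w`, where `w` is a critical point. -/
theorem le_duel_sub_duel (hsc : IsStronglyConvexOn A α f) (hsm : IsSmoothOn A β f)
    (hαβ : α ≤ β) {w x e u : EuclideanSpace ℝ (Fin d)} (hw : w ∈ A) (hgrad : gradient f w = 0)
    {γ l : ℝ} (hγ : 0 ≤ γ) (hl : 0 < l) (he : ‖e‖ = 1) (hxw : x - w = l • e)
    (hball : Metric.closedBall x γ ⊆ A) (hu : ‖u‖ = 1) (hb : 0 ≤ inner ℝ u e) :
    2 * (γ * (2 * α * l - 2 * (β - α) * γ ^ 2 / l - (β - α) * γ / 2)) * inner ℝ u e ≤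
      (f (x + γ • u) - f (x - γ • u)) -
        (f (x + γ • (u - (2 * inner ℝ u e : ℝ) • e)) -
          f (x - γ • (u - (2 * inner ℝ u e : ℝ) • e))) := by
  set b : ℝ := inner ℝ u e with hbdef
  have hb1 : b ≤ 1 := by
    have := real_inner_le_norm u e
    rwa [hu, he, one_mul] at this
  set q : EuclideanSpace ℝ (Fin d) := γ • (u - b • e) with hq
  set z : EuclideanSpace ℝ (Fin d) := (γ * b) • e with hz
  have horth : inner ℝ (u - b • e) e = 0 := by
    rw [inner_sub_left, inner_smul_left, real_inner_self_eq_norm_sq, he]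
    simp [hbdef]
  have hpyth : ‖u - b • e‖ ^ 2 = 1 - b ^ 2 := by
    rw [norm_sub_sq_real, inner_smul_right, norm_smul, he, hu, ← hbdef, Real.norm_eq_abs,
      mul_one, sq_abs]
    ring
  have hqn : ‖q‖ ^ 2 ≤ γ ^ 2 := by
    rw [hq, norm_smul, mul_pow, hpyth, Real.norm_eq_abs, sq_abs]
    linear_combination mul_nonneg (sq_nonneg γ) (sq_nonneg b)
  have hqz : ‖u - (2 * b) • e‖ = 1 := by
    have : ‖u - (2 * b) • e‖ ^ 2 = 1 := by
      rw [norm_sub_sq_real, inner_smul_right, norm_smul, he, hu, ← hbdef, Real.norm_eq_abs,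
        mul_one, sq_abs]
      ring
    nlinarith [norm_nonneg (u - (2 * b) • e)]
  have mem : ∀ s : EuclideanSpace ℝ (Fin d), ‖s‖ ≤ γ → x + s ∈ A := fun s hs =>
    hball (by simpa [Metric.mem_closedBall, dist_eq_norm] using hs)
  have hqγ : ‖q‖ ≤ γ := abs_le_of_sq_le_sq' hqn hγ |>.2
  have hγu : ‖γ • u‖ ≤ γ := by rw [norm_smul, hu, Real.norm_eq_abs, abs_of_nonneg hγ, mul_one]
  have hγu' : ‖γ • (u - (2 * b) • e)‖ ≤ γ := by
    rw [norm_smul, hqz, Real.norm_eq_abs, abs_of_nonneg hγ, mul_one]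
  have a1 : x + γ • u = x + q + z := by rw [hq, hz]; module
  have a2 : x + γ • (u - (2 * b) • e) = x + q - z := by rw [hq, hz]; module
  have a3 : x - γ • (u - (2 * b) • e) = x - q + z := by rw [hq, hz]; module
  have a4 : x - γ • u = x - q - z := by rw [hq, hz]; module
  have m1 : x + q + z ∈ A := a1 ▸ mem _ hγu
  have m2 : x + q - z ∈ A := a2 ▸ mem _ hγu'
  have m3 : x - q + z ∈ A := by
    rw [← a3, sub_eq_add_neg]; exact mem _ (by rwa [norm_neg])
  have m4 : x - q - z ∈ A := by
    rw [← a4, sub_eq_add_neg]; exact mem _ (by rwa [norm_neg])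
  have mq : x + q ∈ A := mem _ hqγ
  have mq' : x - q ∈ A := by rw [sub_eq_add_neg]; exact mem _ (by rwa [norm_neg])
  have t1 := two_mul_inner_gradient_le hsc hsm mq m1 m2
  have t2 := two_mul_inner_gradient_le hsc hsm mq' m3 m4
  have t3 := le_inner_gradient_add_gradient hsc hsm hw hgrad mq mq'
  rw [a1, a2, a3, a4]
  have hzn : ‖z‖ ^ 2 = γ ^ 2 * b ^ 2 := by
    rw [hz, norm_smul, he, mul_one, Real.norm_eq_abs, sq_abs, mul_pow]
  rw [hxw, inner_smul_right, norm_smul, he, mul_one, Real.norm_eq_abs, sq_abs,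
    inner_add_left] at t3
  rw [hzn, hz, inner_smul_right] at t1 t2
  rw [← hz] at t1 t2
  set G : ℝ := inner ℝ (gradient f (x + q)) e + inner ℝ (gradient f (x - q)) e with hG
  have t4 : 2 * α * l - 2 * (β - α) * γ ^ 2 / l ≤ G := by
    have : l * (2 * α * l - 2 * (β - α) * γ ^ 2 / l) ≤ l * G := by
      have e1 : l * (2 * α * l - 2 * (β - α) * γ ^ 2 / l) =
          2 * α * l ^ 2 - 2 * (β - α) * γ ^ 2 := by field_simp
      rw [e1]
      nlinarith [mul_le_mul_of_nonneg_left hqn (sub_nonneg.2 hαβ)]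
    exact le_of_mul_le_mul_left this hl
  have t5 : γ * b * (2 * α * l - 2 * (β - α) * γ ^ 2 / l) ≤ γ * b * G :=
    mul_le_mul_of_nonneg_left t4 (mul_nonneg hγ hb)
  have t6 : (β - α) * γ ^ 2 * b ^ 2 ≤ (β - α) * γ ^ 2 * b := by
    apply mul_le_mul_of_nonneg_left _ (mul_nonneg (sub_nonneg.2 hαβ) (sq_nonneg γ))
    nlinarith
  rw [hG] at t5
  linear_combination t1 + t2 + 2 * t5 + t6

end FirstOrder

theorem reflection_orthogonal_unit {d : ℕ} {e : EuclideanSpace ℝ (Fin d)} (he : ‖e‖ = 1)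
    (u : EuclideanSpace ℝ (Fin d)) :
    (ℝ ∙ e)ᗮ.reflection u = u - (2 * inner ℝ u e : ℝ) • e := by
  rw [Submodule.reflection_orthogonal_apply, Submodule.reflection_singleton_apply, he,
    real_inner_comm]
  simp
  module

/-- Lower bound on the mean drift in a direction `e`, by symmetrization in the hyperplane
orthogonal to `e`. -/
theorem le_integral_transfer_mul_inner {d : ℕ} (hd : 1 ≤ d) {ρ : ℝ → ℝ} {p r c κ : ℝ}
    (hρ : IsAdmissibleTransfer ρ p r c) (hκ : 0 ≤ κ) {e : EuclideanSpace ℝ (Fin d)}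
    (he : ‖e‖ = 1) {g : EuclideanSpace ℝ (Fin d) → ℝ} (hg : Measurable g)
    (hgr : ∀ u, ‖u‖ = 1 → |g u| ≤ r)
    (hsym : ∀ u, ‖u‖ = 1 → 0 ≤ inner ℝ u e →
      2 * κ * inner ℝ u e ≤ g u - g (u - (2 * inner ℝ u e : ℝ) • e)) :
    c * κ ^ p * (1 / d : ℝ) ^ ((p + 1) / 2) ≤ ∫ u, ρ (g u) * inner ℝ u e ∂(unifSphere d) := by
  have hp := hρ.one_le_p
  have hc := hρ.c_pos
  have hρm : Measurable ρ := hρ.differentiable.continuous.measurable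
  have hle : ∀ u : EuclideanSpace ℝ (Fin d), ‖u‖ = 1 → |inner ℝ u e| ≤ 1 := fun u hu => by
    have := abs_real_inner_le_norm u e
    rwa [hu, he, one_mul] at this
  set L := (ℝ ∙ e)ᗮ.reflection with hL
  have hLu : ∀ u, L u = u - (2 * inner ℝ u e : ℝ) • e := reflection_orthogonal_unit he
  have hLn : ∀ u, ‖L u‖ = ‖u‖ := fun u => L.norm_map u
  have hLL : ∀ u, L (L u) = u := fun u => Submodule.reflection_reflection _ u
  have hLe : ∀ u, inner ℝ (L u) e = -inner ℝ u e := by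
    intro u
    rw [hLu, inner_sub_left, inner_smul_left, real_inner_self_eq_norm_sq, he]
    simp
    ring
  have hLm : Measurable L := L.continuous.measurable
  have hF : ∀ h : EuclideanSpace ℝ (Fin d) → ℝ, Measurable h →
      Integrable (fun u => ρ (h u) * inner ℝ u e) (unifSphere d) := by
    intro h hh
    refine integrable_unifSphere hd ((hρm.comp hh).mul (by fun_prop)) (C := 1) fun u hu => ?_
    rw [abs_mul]
    exact mul_le_one₀ (hρ.abs_le_one _) (abs_nonneg _) (hle u hu)
  have hswap : ∫ u, ρ (g u) * inner ℝ u e ∂(unifSphere d) =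
      -∫ u, ρ (g (L u)) * inner ℝ u e ∂(unifSphere d) := by
    rw [← (measurePreserving_unifSphere L).integral_comp L.toHomeomorph.measurableEmbedding,
      ← integral_neg]
    refine integral_congr_ae (Filter.Eventually.of_forall fun u => ?_)
    simp only [hLe]
    ring
  have hhalf : ∫ u, ρ (g u) * inner ℝ u e ∂(unifSphere d) =
      ∫ u, (1 / 2 : ℝ) * (ρ (g u) * inner ℝ u e - ρ (g (L u)) * inner ℝ u e) ∂(unifSphere d) := by
    rw [integral_const_mul, integral_sub (hF g hg) (hF (fun u => g (L u)) (hg.comp hLm))]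
    linarith
  have hpos : ∀ u, ‖u‖ = 1 → 0 ≤ inner ℝ u e →
      2 * (c * κ ^ p * |inner ℝ u e| ^ (p + 1)) ≤ (ρ (g u) - ρ (g (L u))) * inner ℝ u e := by
    intro u hu hb
    have h1 := hsym u hu hb
    rw [← hLu] at h1
    have h0 : 0 ≤ 2 * κ * inner ℝ u e := by positivity
    have h2 := hρ.rpow_le_sub (hgr (L u) ((hLn u).trans hu)) (hgr u hu) (by linarith)
    have h3 : (2 * κ * inner ℝ u e) ^ p ≤ (g u - g (L u)) ^ p :=
      Real.rpow_le_rpow h0 h1 (by linarith)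
    rw [Real.mul_rpow (by positivity) hb, Real.mul_rpow (by norm_num) hκ] at h3
    have h4 : (2 : ℝ) ^ (1 - p) * 2 ^ p = 2 := by
      rw [← Real.rpow_add (by norm_num)]; simp
    have h5 : |inner ℝ u e| ^ (p + 1) = (inner ℝ u e) ^ p * inner ℝ u e := by
      rw [abs_of_nonneg hb, Real.rpow_add_one' hb (by linarith)]
    rw [h5]
    calc 2 * (c * κ ^ p * ((inner ℝ u e) ^ p * inner ℝ u e))
        = (c * 2 ^ (1 - p) * (2 ^ p * κ ^ p * (inner ℝ u e) ^ p)) * inner ℝ u e := by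
          linear_combination
            (-(c * κ ^ p * ((inner ℝ u e) ^ p * inner ℝ u e))) * h4
      _ ≤ (c * 2 ^ (1 - p) * (g u - g (L u)) ^ p) * inner ℝ u e := by gcongr
      _ ≤ _ := by gcongr
  have hint : Integrable (fun u : EuclideanSpace ℝ (Fin d) => |inner ℝ u e| ^ (p + 1))
      (unifSphere d) := by
    refine integrable_unifSphere hd ?_ (C := 1) fun u hu => ?_
    · exact (Real.continuous_rpow_const (by linarith)).measurable.comp (by fun_prop)
    · rw [abs_of_nonneg (Real.rpow_nonneg (abs_nonneg _) _)]
      exact Real.rpow_le_one (abs_nonneg _) (hle u hu) (by linarith)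
  calc c * κ ^ p * (1 / d : ℝ) ^ ((p + 1) / 2)
      ≤ c * κ ^ p * ∫ u, |inner ℝ u e| ^ (p + 1) ∂(unifSphere d) := by
        gcongr
        exact rpow_le_integral_inner_rpow_unifSphere hd he hp
    _ = ∫ u, c * κ ^ p * |inner ℝ u e| ^ (p + 1) ∂(unifSphere d) := by rw [integral_const_mul]
    _ ≤ _ := by
        rw [hhalf]
        refine integral_mono_ae (hint.const_mul _)
          (((hF g hg).sub (hF _ (hg.comp hLm))).const_mul _) ?_
        filter_upwards [ae_norm_eq_one_unifSphere d] with u hu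
        rcases le_total 0 (inner ℝ u e) with hb | hb
        · linarith [hpos u hu hb]
        · have := hpos (L u) ((hLn u).trans hu) (by rw [hLe]; linarith)
          rw [hLL, hLe, abs_neg] at this
          linarith

section Excess

variable {E : Type*} [NormedAddCommGroup E]

/-- The distance from `x` to the closed ball of radius `a` about `w`. -/
noncomputable def ballExcess (w : E) (a : ℝ) (x : E) : ℝ := max (‖x - w‖ - a) 0

theorem ballExcess_nonneg (w : E) (a : ℝ) (x : E) : 0 ≤ ballExcess w a x := le_max_right _ _

theorem ballExcess_le {w : E} {a : ℝ} (ha : 0 ≤ a) (x : E) : ballExcess w a x ≤ ‖x - w‖ :=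
  max_le (by linarith) (norm_nonneg _)

theorem norm_sub_le_ballExcess_add (w : E) (a : ℝ) (x : E) : ‖x - w‖ ≤ ballExcess w a x + a := by
  linarith [le_max_left (‖x - w‖ - a) 0, show ballExcess w a x = max (‖x - w‖ - a) 0 from rfl]

theorem ballExcess_eq {w : E} {a : ℝ} {x : E} (h : 0 < ballExcess w a x) :
    ‖x - w‖ = ballExcess w a x + a := by
  unfold ballExcess at h ⊢
  rcases le_total (‖x - w‖ - a) 0 with h1 | h1
  · rw [max_eq_right h1] at h; exact absurd h (lt_irrefl 0)
  · rw [max_eq_left h1]; ring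

theorem measurable_ballExcess [MeasurableSpace E] [BorelSpace E] (w : E) (a : ℝ) :
    Measurable (ballExcess w a) := by
  have : Continuous (ballExcess w a) := by unfold ballExcess; fun_prop
  exact this.measurable

variable [NormedSpace ℝ E]

/-- The vector from the nearest point of the closed ball of radius `a` about `w` to `x`. -/
noncomputable def ballExcessVec (w : E) (a : ℝ) (x : E) : E :=
  (ballExcess w a x / ‖x - w‖) • (x - w)

theorem norm_ballExcessVec {w : E} {a : ℝ} (ha : 0 ≤ a) (x : E) :
    ‖ballExcessVec w a x‖ = ballExcess w a x := by
  rw [ballExcessVec, norm_smul, Real.norm_of_nonneg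
    (div_nonneg (ballExcess_nonneg _ _ _) (norm_nonneg _))]
  refine div_mul_cancel_of_imp fun h => ?_
  exact le_antisymm (h ▸ ballExcess_le ha x) (ballExcess_nonneg _ _ _)

theorem measurable_ballExcessVec [MeasurableSpace E] [BorelSpace E] [SecondCountableTopology E]
    (w : E) (a : ℝ) : Measurable (ballExcessVec w a) := by
  unfold ballExcessVec
  exact ((measurable_ballExcess w a).div (by fun_prop)).smul (by fun_prop)

theorem sub_ballExcessVec_mem {S : Set E} (hS : Convex ℝ S) {w x : E} (hw : w ∈ S) (hx : x ∈ S)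
    {a : ℝ} (ha : 0 ≤ a) : x - ballExcessVec w a x ∈ S := by
  have h0 : 0 ≤ ballExcess w a x / ‖x - w‖ :=
    div_nonneg (ballExcess_nonneg _ _ _) (norm_nonneg _)
  have h1 : ballExcess w a x / ‖x - w‖ ≤ 1 := div_le_one_of_le₀ (ballExcess_le ha x) (norm_nonneg _)
  have := hS hx hw (sub_nonneg.2 h1) h0 (by ring)
  convert this using 1
  rw [ballExcessVec]
  module

theorem ballExcess_le_norm_sub {w : E} {a : ℝ} (ha : 0 ≤ a) (x z : E) :
    ballExcess w a z ≤ ‖z - (x - ballExcessVec w a x)‖ := by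
  refine max_le ?_ (norm_nonneg _)
  have h1 : ‖x - ballExcessVec w a x - w‖ ≤ a := by
    have e : x - ballExcessVec w a x - w = (1 - ballExcess w a x / ‖x - w‖) • (x - w) := by
      rw [ballExcessVec]; module
    have hr : ballExcess w a x / ‖x - w‖ ≤ 1 :=
      div_le_one_of_le₀ (ballExcess_le ha x) (norm_nonneg _)
    rw [e, norm_smul, Real.norm_of_nonneg (by linarith), sub_mul, one_mul]
    rw [div_mul_cancel_of_imp fun h => le_antisymm (h ▸ ballExcess_le ha x)
      (ballExcess_nonneg _ _ _)]
    linarith [norm_sub_le_ballExcess_add w a x]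
  have h2 := norm_add_le (z - (x - ballExcessVec w a x)) (x - ballExcessVec w a x - w)
  rw [sub_add_sub_cancel] at h2
  linarith

end Excess

/-- The data of the strongly convex and smooth optimization problem with relative feedback. -/
structure IsDuelProblem {d : ℕ} (S : Set (EuclideanSpace ℝ (Fin d)))
    (f : EuclideanSpace ℝ (Fin d) → ℝ) (ρ : ℝ → ℝ) (α β c p r G : ℝ)
    (w : EuclideanSpace ℝ (Fin d)) : Prop where
  one_le_dim : 1 ≤ d
  α_pos : 0 < α
  β_pos : 0 < β
  transfer : IsAdmissibleTransfer ρ p r c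
  convex : Convex ℝ S
  closed : IsClosed S
  bounded : Bornology.IsBounded S
  diff : ∀ y ∈ Metric.cthickening G S, DifferentiableAt ℝ f y
  strong : IsStronglyConvexOn (Metric.cthickening G S) α f
  smooth : IsSmoothOn (Metric.cthickening G S) β f
  gap : ∀ y ∈ S, ∀ v, ‖v‖ ≤ G → |f (y + v) - f (y - v)| ≤ r
  mem_interior : w ∈ interior S
  isMin : IsMinOn f S w

section Problem

variable {d : ℕ} {S : Set (EuclideanSpace ℝ (Fin d))} {f : EuclideanSpace ℝ (Fin d) → ℝ}
  {ρ : ℝ → ℝ} {α β c p r G : ℝ} {w : EuclideanSpace ℝ (Fin d)}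

theorem IsDuelProblem.mem (h : IsDuelProblem S f ρ α β c p r G w) : w ∈ S :=
  interior_subset h.mem_interior

theorem IsDuelProblem.gradient_eq_zero (h : IsDuelProblem S f ρ α β c p r G w) :
    gradient f w = 0 := by
  have hloc : IsLocalMin f w := h.isMin.isLocalMin (mem_interior_iff_mem_nhds.1 h.mem_interior)
  rw [gradient, hloc.fderiv_eq_zero, map_zero]

theorem IsDuelProblem.exists_ne (h : IsDuelProblem S f ρ α β c p r G w) :
    ∃ x ∈ S, x ≠ w := by
  have : Nonempty (Fin d) := ⟨⟨0, h.one_le_dim⟩⟩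
  have hnt : Nontrivial (EuclideanSpace ℝ (Fin d)) := inferInstance
  have hn := mem_interior_iff_mem_nhds.1 h.mem_interior
  obtain ⟨x, hx, hxS⟩ := (mem_closure_iff_nhds.1
    (show w ∈ closure ({w}ᶜ) by rw [closure_compl_singleton]; trivial)) S hn
  exact ⟨x, hx, hxS⟩

theorem IsDuelProblem.α_le_β (h : IsDuelProblem S f ρ α β c p r G w) : α ≤ β := by
  obtain ⟨x, hx, hxw⟩ := h.exists_ne
  have hxA := Metric.self_subset_cthickening (δ := G) S hx
  have hwA := Metric.self_subset_cthickening (δ := G) S h.mem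
  have h1 := h.strong x hxA w hwA
  have h2 := h.smooth x hxA w hwA
  have h3 : 0 < ‖x - w‖ ^ 2 := by
    have := norm_pos_iff.2 (sub_ne_zero.2 hxw)
    positivity
  nlinarith

theorem IsDuelProblem.diam_pos (h : IsDuelProblem S f ρ α β c p r G w) : 0 < Metric.diam S := by
  obtain ⟨x, hx, hxw⟩ := h.exists_ne
  exact (dist_pos.2 hxw).trans_le (Metric.dist_le_diam_of_mem h.bounded hx h.mem)

theorem IsDuelProblem.norm_sub_le_diam (h : IsDuelProblem S f ρ α β c p r G w)
    {x : EuclideanSpace ℝ (Fin d)} (hx : x ∈ S) : ‖x - w‖ ≤ Metric.diam S := by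
  rw [← dist_eq_norm]
  exact Metric.dist_le_diam_of_mem h.bounded hx h.mem

theorem IsDuelProblem.sub_le (h : IsDuelProblem S f ρ α β c p r G w)
    {y : EuclideanSpace ℝ (Fin d)} (hy : y ∈ S) :
    f y - f w ≤ β / 2 * ‖y - w‖ ^ 2 := by
  have := h.smooth y (Metric.self_subset_cthickening S hy) w
    (Metric.self_subset_cthickening S h.mem)
  rwa [h.gradient_eq_zero, inner_zero_left, zero_add] at this

theorem closedBall_subset_cthickening
    {x : EuclideanSpace ℝ (Fin d)} (hx : x ∈ S) {γ : ℝ} (hγ : γ ≤ G) :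
    Metric.closedBall x γ ⊆ Metric.cthickening G S := fun y hy =>
  Metric.mem_cthickening_of_dist_le y x G S hx ((Metric.mem_closedBall.1 hy).trans hγ)

/-- `f` on the query domain, extended by zero. -/
noncomputable def queryValue (S : Set (EuclideanSpace ℝ (Fin d))) (G : ℝ)
    (f : EuclideanSpace ℝ (Fin d) → ℝ) : EuclideanSpace ℝ (Fin d) → ℝ :=
  (Metric.cthickening G S).indicator f

theorem queryValue_add {x : EuclideanSpace ℝ (Fin d)} (hx : x ∈ S)
    {v : EuclideanSpace ℝ (Fin d)} (hv : ‖v‖ ≤ G) : queryValue S G f (x + v) = f (x + v) := by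
  refine Set.indicator_of_mem (Metric.mem_cthickening_of_dist_le _ x G S hx ?_) f
  rwa [dist_eq_norm, add_sub_cancel_left]

theorem queryValue_sub {x : EuclideanSpace ℝ (Fin d)} (hx : x ∈ S)
    {v : EuclideanSpace ℝ (Fin d)} (hv : ‖v‖ ≤ G) : queryValue S G f (x - v) = f (x - v) := by
  rw [sub_eq_add_neg]
  exact queryValue_add hx (by rwa [norm_neg])

theorem IsDuelProblem.measurable_queryValue (h : IsDuelProblem S f ρ α β c p r G w) :
    Measurable (queryValue S G f) := by
  classical
  rw [queryValue, ← Set.piecewise_eq_indicator]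
  exact ContinuousOn.measurable_piecewise
    (fun y hy => (h.diff y hy).continuousAt.continuousWithinAt)
    continuousOn_const Metric.isClosed_cthickening.measurableSet

end Problem

theorem mul_rpow_le_add_rpow {p y : ℝ} (hp : 1 ≤ p) (hy : 0 ≤ y) :
    80 * p * (1 / 80) ^ p * y ≤ (y + 23 / 500) ^ p := by
  have h1 : p ≤ Real.exp (p - 1) := by linarith [Real.add_one_le_exp (p - 1)]
  have h2 : Real.exp (p - 1) ≤ (80 * (y + 23 / 500)) ^ (p - 1) := by
    rw [← Real.exp_one_rpow]
    refine Real.rpow_le_rpow (Real.exp_pos 1).le ?_ (by linarith)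
    linarith [Real.exp_one_lt_d9]
  have h3 : (80 * (y + 23 / 500)) ^ (p - 1) * (80 * (y + 23 / 500)) =
      80 ^ p * (y + 23 / 500) ^ p := by
    rw [← Real.mul_rpow (by norm_num) (by linarith), ← Real.rpow_add_one' (by linarith) (by linarith),
      sub_add_cancel]
  have h4 : (80 : ℝ) ^ p * (1 / 80) ^ p = 1 := by
    rw [← Real.mul_rpow (by norm_num) (by norm_num)]; norm_num
  have h5 : 80 * p * y ≤ 80 ^ p * (y + 23 / 500) ^ p := by
    rw [← h3]
    nlinarith [mul_le_mul_of_nonneg_right (h1.trans h2) (show 0 ≤ 80 * (y + 23 / 500) by linarith)]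
  have h6 : (0 : ℝ) ≤ (1 / 80) ^ p := by positivity
  calc 80 * p * (1 / 80) ^ p * y = (1 / 80) ^ p * (80 * p * y) := by ring
    _ ≤ (1 / 80) ^ p * (80 ^ p * (y + 23 / 500) ^ p) := by gcongr
    _ = (80 ^ p * (1 / 80) ^ p) * (y + 23 / 500) ^ p := by ring
    _ = _ := by rw [h4, one_mul]

theorem epochB_pos {α β c p : ℝ} {d : ℕ} (hd : 1 ≤ d) (hα : 0 < α) (hβ : 0 < β) (hc : 0 < c)
    (hp : 1 ≤ p) : 0 < epochB α β c p d := by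
  unfold epochB cTilde
  have : (0 : ℝ) < d := by exact_mod_cast hd
  positivity

theorem epochB_mul_rpow_le {α β c p R : ℝ} {d : ℕ} (hd : 1 ≤ d) (hα : 0 < α) (hβ : 0 < β)
    (hc : 0 < c) (hp : 1 ≤ p) (hR : 0 < R) :
    epochB α β c p d * R ^ (2 * p) ≤
      40 * p * c * (1 / 80) ^ p * (α ^ 2 * R ^ 2 / (20 * β * √d)) ^ p * (1 / d) ^ ((p + 1) / 2) := by
  have hd0 : (0 : ℝ) < d := by exact_mod_cast hd
  have e1 : (cTilde : ℝ) ^ (2 * p - 1) = 20 * (1 / 20) ^ (2 * p) := by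
    rw [cTilde, Real.rpow_sub_one (by norm_num)]
    ring
  have e2 : ((1 : ℝ) / 20) ^ (2 * p) = (1 / 400) ^ p := by
    rw [Real.rpow_mul (by norm_num)]; norm_num
  have e3 : R ^ (2 * p) = (R ^ 2) ^ p := by
    rw [Real.rpow_mul hR.le]; norm_num
  have e4 : (1 : ℝ) / (d : ℝ) ^ ((2 * p + 1) / 2) = (1 / √d) ^ p * (1 / d) ^ ((p + 1) / 2) := by
    simp only [Real.sqrt_eq_rpow, one_div]
    rw [← Real.rpow_neg hd0.le,
      ← Real.rpow_neg hd0.le, ← Real.rpow_neg_one (d : ℝ), ← Real.rpow_mul hd0.le,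
      ← Real.rpow_mul hd0.le, ← Real.rpow_add hd0]
    congr 1
    ring
  have e5 : (1 / 80 : ℝ) ^ p * (α ^ 2 * R ^ 2 / (20 * β * √d)) ^ p =
      (α ^ 2 / (4 * β)) ^ p * (1 / 400) ^ p * (R ^ 2) ^ p * (1 / √d) ^ p := by
    have hs : 0 < √(d : ℝ) := Real.sqrt_pos.2 hd0
    rw [← Real.mul_rpow (by positivity) (by positivity),
      ← Real.mul_rpow (by positivity) (by positivity),
      ← Real.mul_rpow (by positivity) (by positivity),
      ← Real.mul_rpow (by positivity) (by positivity)]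
    congr 1
    field_simp
    norm_num
  have hmax : 2 * c * p / max 1 (α + β) ≤ 2 * c * p :=
    div_le_self (by positivity) (le_max_left _ _)
  calc epochB α β c p d * R ^ (2 * p)
      ≤ 2 * c * p * ((α ^ 2 / (4 * β)) ^ p * (cTilde ^ (2 * p - 1) * (1 / (d : ℝ) ^ ((2 * p + 1) / 2))))
          * R ^ (2 * p) := by
        unfold epochB
        rw [mul_one_div]
        have : (0 : ℝ) ≤ cTilde ^ (2 * p - 1) := by unfold cTilde; positivity
        gcongr
    _ = 40 * p * c * ((α ^ 2 / (4 * β)) ^ p * (1 / 400) ^ p * (R ^ 2) ^ p * (1 / √d) ^ p) *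
          (1 / d) ^ ((p + 1) / 2) := by
        rw [e1, e2, e3, e4]; ring
    _ = _ := by rw [← e5]; ring

/-- The perturbation used in an epoch of radius `R`. -/
noncomputable def duelStep (α β R : ℝ) (d : ℕ) : ℝ := cTilde * α * R / (2 * β * √(d : ℝ))

section DuelStep

variable {α β R : ℝ} {d : ℕ}

theorem duelStep_pos (hd : 1 ≤ d) (hα : 0 < α) (hβ : 0 < β) (hR : 0 < R) :
    0 < duelStep α β R d := by
  have hd0 : (0 : ℝ) < d := by exact_mod_cast hd
  have hs : 0 < √(d : ℝ) := Real.sqrt_pos.2 hd0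
  unfold duelStep cTilde
  positivity

theorem duelStep_mono (hα : 0 < α) (hβ : 0 < β) {R' : ℝ} (h : R ≤ R') :
    duelStep α β R d ≤ duelStep α β R' d := by
  unfold duelStep cTilde
  gcongr

theorem mul_duelStep_le (hd : 1 ≤ d) (hα : 0 < α) (hβ : 0 < β) (hR : 0 < R) :
    β * duelStep α β R d ≤ α * R / 40 := by
  have hs : 1 ≤ √(d : ℝ) := Real.one_le_sqrt.2 (by exact_mod_cast hd)
  have e : β * duelStep α β R d = (α * R / 40) / √(d : ℝ) := by
    have : √(d : ℝ) ≠ 0 := by positivity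
    unfold duelStep cTilde
    field_simp
    norm_num
  rw [e]
  exact div_le_self (by positivity) hs

theorem duelStep_le (hd : 1 ≤ d) (hα : 0 < α) (hαβ : α ≤ β) (hR : 0 < R) :
    duelStep α β R d ≤ R / 40 := by
  have hβ := hα.trans_le hαβ
  have h1 := mul_duelStep_le hd hα hβ hR
  have h2 : β * duelStep α β R d ≤ β * (R / 40) := by
    refine h1.trans ?_
    rw [mul_div_assoc]
    gcongr
  exact le_of_mul_le_mul_left h2 hβ

theorem two_mul_mul_duelStep (hd : 1 ≤ d) (hβ : 0 < β) :
    2 * α * R * duelStep α β R d = α ^ 2 * R ^ 2 / (20 * β * √d) := by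
  have hd0 : (0 : ℝ) < d := by exact_mod_cast hd
  have hs : 0 < √(d : ℝ) := Real.sqrt_pos.2 hd0
  unfold duelStep cTilde
  field_simp

/-- The slope of the symmetrized duel at distance `l` from the minimizer. -/
noncomputable def duelSlope (α β γ l : ℝ) : ℝ :=
  γ * (2 * α * l - 2 * (β - α) * γ ^ 2 / l - (β - α) * γ / 2)

theorem duelSlope_ge (hd : 1 ≤ d) (hα : 0 < α) (hαβ : α ≤ β) (hR : 0 < R) {l m : ℝ} (hm : 0 < m)
    (hl : m * R ≤ l) :
    duelStep α β R d * (2 * α * l - α * R * (1 / (800 * m) + 1 / 80)) ≤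
      duelSlope α β (duelStep α β R d) l := by
  have hβ := hα.trans_le hαβ
  have hγ := duelStep_pos hd hα hβ hR
  have h1 := mul_duelStep_le hd hα hβ hR
  have h2 := duelStep_le hd hα hαβ hR
  unfold duelSlope
  set γ := duelStep α β R d
  have hl0 : 0 < l := (mul_pos hm hR).trans_le hl
  apply mul_le_mul_of_nonneg_left _ hγ.le
  have h3 : 2 * (β - α) * γ ^ 2 / l ≤ α * R * (1 / (800 * m)) := by
    calc 2 * (β - α) * γ ^ 2 / l ≤ 2 * β * γ ^ 2 / (m * R) := by
          gcongr
          linarith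
      _ = 2 * (β * γ) * γ / (m * R) := by ring
      _ ≤ 2 * (α * R / 40) * (R / 40) / (m * R) := by gcongr
      _ = _ := by field_simp; norm_num
  have h4 : (β - α) * γ / 2 ≤ α * R * (1 / 80) := by nlinarith [mul_pos hα hγ]
  linarith

end DuelStep

section Drift

variable {d : ℕ} {S : Set (EuclideanSpace ℝ (Fin d))} {f : EuclideanSpace ℝ (Fin d) → ℝ}
  {ρ : ℝ → ℝ} {α β c p r G R : ℝ} {w : EuclideanSpace ℝ (Fin d)}

/-- Points far from the minimizer force the step constant to be small: the answers of the duels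
played there are bounded by one. -/
theorem IsDuelProblem.epochB_mul_le (h : IsDuelProblem S f ρ α β c p r G w) (hR : 0 < R)
    (hG : duelStep α β R d ≤ G) {x : EuclideanSpace ℝ (Fin d)} (hx : x ∈ S)
    (hl : R / 4 ≤ ‖x - w‖) :
    epochB α β c p d * R ^ (2 * p) * (193 / 100 * ‖x - w‖) ≤ R := by
  have hd := h.one_le_dim
  have hα := h.α_pos
  have hβ := h.β_pos
  have hαβ := h.α_le_β
  have hρ := h.transfer
  have hp := hρ.one_le_p
  have hc := hρ.c_pos
  have hγ := duelStep_pos hd hα hβ hR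
  have hslope := duelSlope_ge hd hα hαβ hR (l := ‖x - w‖) (m := 1 / 4) (by norm_num) (by linarith)
  have hθ := two_mul_mul_duelStep (α := α) (R := R) hd hβ
  have hBR := epochB_mul_rpow_le (R := R) hd hα hβ hc hp hR
  rw [← hθ] at hBR
  set l := ‖x - w‖ with hldef
  set γ := duelStep α β R d
  have hl0 : 0 < l := by linarith
  set e : EuclideanSpace ℝ (Fin d) := l⁻¹ • (x - w) with he
  have hen : ‖e‖ = 1 := by
    rw [he, norm_smul, norm_inv, norm_norm]; exact inv_mul_cancel₀ hl0.ne'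
  have hxw : x - w = l • e := by rw [he, smul_inv_smul₀ hl0.ne']
  have hgap := le_duel_sub_duel h.strong h.smooth hαβ
    (Metric.self_subset_cthickening S h.mem) h.gradient_eq_zero hγ.le hl0 hen hxw
    (closedBall_subset_cthickening hx hG) hen (by rw [real_inner_self_eq_norm_sq]; positivity)
  have e1 : e - (2 * inner ℝ e e : ℝ) • e = -e := by
    rw [real_inner_self_eq_norm_sq, hen]; module
  rw [e1, real_inner_self_eq_norm_sq, hen, smul_neg, sub_neg_eq_add, ← sub_eq_add_neg] at hgap
  change 2 * duelSlope α β γ l * 1 ^ 2 ≤ _ at hgap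
  have hγe : ‖γ • e‖ ≤ G := by
    rw [norm_smul, hen, Real.norm_of_nonneg hγ.le, mul_one]; exact hG
  have hr := (abs_le.1 (h.gap x hx _ hγe)).2
  set g := f (x + γ • e) - f (x - γ • e)
  have h1 : 193 / 100 * α * γ * l ≤ g := by
    have : 193 / 100 * α * γ * l ≤ γ * (2 * α * l - α * R * (1 / (800 * (1 / 4)) + 1 / 80)) := by
      have : α * γ * (R / 4) ≤ α * γ * l := by gcongr
      nlinarith
    linarith
  have h0 : 0 ≤ 193 / 100 * α * γ * l := by positivity
  have h2 : c * (193 / 100 * α * γ * l) ^ p ≤ 1 := by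
    calc c * (193 / 100 * α * γ * l) ^ p ≤ c * g ^ p := by gcongr
      _ ≤ ρ g := hρ.rpow_le (h0.trans h1) hr
      _ ≤ 1 := (hρ.mem_Icc g).2
  set s := R / (772 / 10 * l) with hs
  have hs0 : 0 < s := by positivity
  have h3 : (1 / 80 : ℝ) ^ p * (2 * α * R * γ) ^ p = (193 / 100 * α * γ * l) ^ p * s ^ p := by
    rw [← Real.mul_rpow (by norm_num) (by positivity), ← Real.mul_rpow h0 hs0.le, hs]
    congr 1
    field_simp
    norm_num
  have hs1 : s ≤ (Real.exp 1)⁻¹ := by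
    have : s ≤ 1 / 3 := by
      rw [hs, div_le_iff₀ (by positivity)]
      linarith
    refine this.trans ?_
    rw [one_div]
    apply inv_anti₀ (Real.exp_pos 1)
    linarith [Real.exp_one_lt_d9]
  have h4 : p * s ^ (p - 1) ≤ 1 := by
    have a1 : s ^ (p - 1) ≤ ((Real.exp 1)⁻¹) ^ (p - 1) :=
      Real.rpow_le_rpow hs0.le hs1 (by linarith)
    rw [Real.inv_rpow (Real.exp_pos 1).le, Real.exp_one_rpow] at a1
    have a2 : p ≤ Real.exp (p - 1) := by linarith [Real.add_one_le_exp (p - 1)]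
    calc p * s ^ (p - 1) ≤ Real.exp (p - 1) * (Real.exp (p - 1))⁻¹ := by gcongr
      _ = 1 := mul_inv_cancel₀ (Real.exp_pos _).ne'
  have h5 : s ^ p = s ^ (p - 1) * s := by
    rw [← Real.rpow_add_one hs0.ne', sub_add_cancel]
  have hd1 : (1 / d : ℝ) ^ ((p + 1) / 2) ≤ 1 := by
    refine Real.rpow_le_one (by positivity) ?_ (by linarith)
    rw [div_le_one (by exact_mod_cast hd)]
    exact_mod_cast hd
  have h6 : epochB α β c p d * R ^ (2 * p) ≤ 40 * s := by
    calc epochB α β c p d * R ^ (2 * p)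
        ≤ 40 * p * c * ((1 / 80) ^ p * (2 * α * R * γ) ^ p) * (1 / d) ^ ((p + 1) / 2) := by
          rw [← mul_assoc]; exact hBR
      _ ≤ 40 * p * c * ((1 / 80) ^ p * (2 * α * R * γ) ^ p) * 1 := by gcongr
      _ = 40 * (c * (193 / 100 * α * γ * l) ^ p) * (p * s ^ (p - 1)) * s := by
          rw [h3, h5]; ring
      _ ≤ 40 * 1 * 1 * s := by gcongr
      _ = 40 * s := by ring
  calc epochB α β c p d * R ^ (2 * p) * (193 / 100 * l) ≤ 40 * s * (193 / 100 * l) := by gcongr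
    _ = R := by rw [hs]; field_simp; norm_num

/-- The mean decrease produced by one round at a point `x`. -/
theorem IsDuelProblem.le_integral_drift (h : IsDuelProblem S f ρ α β c p r G w) (hR : 0 < R)
    (hG : duelStep α β R d ≤ G) {x : EuclideanSpace ℝ (Fin d)} (hx : x ∈ S) :
    2 * (epochB α β c p d * R ^ (2 * p)) * ballExcess w (R / 16) x ^ 2 / R ≤
      ∫ u, ρ (queryValue S G f (x + duelStep α β R d • u) -
        queryValue S G f (x - duelStep α β R d • u)) *
          inner ℝ u (ballExcessVec w (R / 16) x) ∂(unifSphere d) := by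
  rcases (ballExcess_nonneg w (R / 16) x).eq_or_lt with h0 | hpos
  · simp [ballExcessVec, ← h0]
  have hd := h.one_le_dim
  have hα := h.α_pos
  have hβ := h.β_pos
  have hαβ := h.α_le_β
  have hρ := h.transfer
  have hp := hρ.one_le_p
  have hc := hρ.c_pos
  have hγ := duelStep_pos hd hα hβ hR
  have hl := ballExcess_eq hpos
  have hslope := duelSlope_ge hd hα hαβ hR (l := ‖x - w‖) (m := 1 / 16) (by norm_num)
    (by linarith)
  have hθ := two_mul_mul_duelStep (α := α) (R := R) hd hβ
  have hBR := epochB_mul_rpow_le (R := R) hd hα hβ hc hp hR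
  rw [← hθ] at hBR
  unfold ballExcessVec
  set δ := ballExcess w (R / 16) x
  set l := ‖x - w‖ with hldef
  set γ := duelStep α β R d
  have hl0 : 0 < l := by linarith
  set e : EuclideanSpace ℝ (Fin d) := l⁻¹ • (x - w) with he
  have hen : ‖e‖ = 1 := by
    rw [he, norm_smul, norm_inv, norm_norm]; exact inv_mul_cancel₀ hl0.ne'
  have hxw : x - w = l • e := by rw [he, smul_inv_smul₀ hl0.ne']
  have hγu : ∀ u : EuclideanSpace ℝ (Fin d), ‖u‖ = 1 → ‖γ • u‖ ≤ G := fun u hu => by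
    rw [norm_smul, hu, Real.norm_of_nonneg hγ.le, mul_one]; exact hG
  set y := δ / R with hy
  have hy0 : 0 < y := div_pos hpos hR
  have hδy : δ = R * y := by rw [hy]; field_simp
  have hκ : 2 * α * R * γ * (y + 23 / 500) ≤ duelSlope α β γ l := by
    refine le_trans ?_ hslope
    rw [hl, hδy]
    nlinarith [mul_pos (mul_pos hα hR) hγ]
  have hκ1 : 0 ≤ 2 * α * R * γ * (y + 23 / 500) := by positivity
  have hqm := h.measurable_queryValue
  have key := le_integral_transfer_mul_inner hd hρ (hκ1.trans hκ) hen
    (g := fun u => queryValue S G f (x + γ • u) - queryValue S G f (x - γ • u))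
    ((hqm.comp (by fun_prop)).sub (hqm.comp (by fun_prop)))
    (fun u hu => by
      simp only [queryValue_add hx (hγu u hu), queryValue_sub hx (hγu u hu)]
      exact h.gap x hx _ (hγu u hu))
    (fun u hu hb => by
      have hu' : ‖u - (2 * inner ℝ u e : ℝ) • e‖ = 1 := by
        rw [← reflection_orthogonal_unit hen, LinearIsometryEquiv.norm_map, hu]
      simp only [queryValue_add hx (hγu u hu), queryValue_sub hx (hγu u hu),
        queryValue_add hx (hγu _ hu'), queryValue_sub hx (hγu _ hu')]
      exact le_duel_sub_duel h.strong h.smooth hαβ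
        (Metric.self_subset_cthickening S h.mem) h.gradient_eq_zero hγ.le hl0 hen hxw
        (closedBall_subset_cthickening hx hG) hu hb)
  have hvec : (δ / l) • (x - w) = δ • e := by rw [he, smul_smul, div_eq_mul_inv]
  simp only [hvec, inner_smul_right]
  have e1 : ∀ u : EuclideanSpace ℝ (Fin d),
      ρ (queryValue S G f (x + γ • u) - queryValue S G f (x - γ • u)) * (δ * inner ℝ u e) =
      δ * (ρ (queryValue S G f (x + γ • u) - queryValue S G f (x - γ • u)) * inner ℝ u e) :=
    fun u => by ring
  simp only [e1]
  rw [integral_const_mul]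
  refine le_trans ?_ (mul_le_mul_of_nonneg_left key hpos.le)
  have e2 : 2 * (epochB α β c p d * R ^ (2 * p)) * δ ^ 2 / R =
      δ * (2 * (epochB α β c p d * R ^ (2 * p)) * y) := by rw [hy]; ring
  rw [e2]
  apply mul_le_mul_of_nonneg_left _ hpos.le
  calc 2 * (epochB α β c p d * R ^ (2 * p)) * y
      ≤ 2 * (40 * p * c * (1 / 80) ^ p * (2 * α * R * γ) ^ p * (1 / d) ^ ((p + 1) / 2)) * y := by
        gcongr
    _ = c * ((2 * α * R * γ) ^ p * (80 * p * (1 / 80) ^ p * y)) * (1 / d) ^ ((p + 1) / 2) := by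
        ring
    _ ≤ c * ((2 * α * R * γ) ^ p * (y + 23 / 500) ^ p) * (1 / d) ^ ((p + 1) / 2) := by
        gcongr
        exact mul_rpow_le_add_rpow hp hy0.le
    _ = c * (2 * α * R * γ * (y + 23 / 500)) ^ p * (1 / d) ^ ((p + 1) / 2) := by
        rw [← Real.mul_rpow (x := 2 * α * R * γ) (by positivity) (by positivity)]
    _ ≤ _ := by gcongr

end Drift

section Projection

variable {d : ℕ} {S : Set (EuclideanSpace ℝ (Fin d))} {y y' z z' : EuclideanSpace ℝ (Fin d)}

theorem IsProjection.inner_le_zero (hS : Convex ℝ S) (h : IsProjection S z y)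
    {q : EuclideanSpace ℝ (Fin d)} (hq : q ∈ S) : inner ℝ (z - y) (q - y) ≤ 0 := by
  have : Nonempty S := ⟨⟨y, h.1⟩⟩
  refine (norm_eq_iInf_iff_real_inner_le_zero hS h.1).1 (le_antisymm ?_ ?_) q hq
  · refine le_ciInf fun s => ?_
    rw [norm_sub_rev, norm_sub_rev z]
    exact h.2 s s.2
  · exact ciInf_le ⟨0, by rintro _ ⟨s, rfl⟩; exact norm_nonneg _⟩ (⟨y, h.1⟩ : S)

theorem IsProjection.norm_sub_le (hS : Convex ℝ S) (h : IsProjection S z y)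
    (h' : IsProjection S z' y') : ‖y - y'‖ ≤ ‖z - z'‖ := by
  have h1 := h.inner_le_zero hS h'.1
  have h2 := h'.inner_le_zero hS h.1
  have h3 : ‖y - y'‖ * ‖y - y'‖ ≤ ‖z - z'‖ * ‖y - y'‖ := by
    refine le_trans ?_ (real_inner_le_norm (z - z') (y - y'))
    rw [← real_inner_self_eq_norm_mul_norm]
    have e1 : inner ℝ (z - y) (y' - y) = -inner ℝ (z - y) (y - y') := by
      rw [← inner_neg_right, neg_sub]
    have e2 : inner ℝ (z - z') (y - y') - inner ℝ (y - y') (y - y') =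
        inner ℝ (z - y) (y - y') - inner ℝ (z' - y') (y - y') := by
      rw [← inner_sub_left, ← inner_sub_left]
      congr 1
      abel
    linarith
  rcases (norm_nonneg (y - y')).eq_or_lt with h0 | h0
  · rw [← h0]; exact norm_nonneg _
  · exact le_of_mul_le_mul_right h3 h0

theorem isProjection_self (hy : y ∈ S) : IsProjection S y y :=
  ⟨hy, fun w _ => by simp⟩

theorem measurable_of_isProjection {Ω : Type*} [MeasurableSpace Ω] (hS : Convex ℝ S)
    (hc : IsClosed S) (hne : S.Nonempty) {Y Z : Ω → EuclideanSpace ℝ (Fin d)}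
    (hZ : Measurable Z) (h : ∀ ω, IsProjection S (Z ω) (Y ω)) : Measurable Y := by
  have hex : ∀ z, ∃ y, IsProjection S z y := by
    intro z
    obtain ⟨y, hy, hmin⟩ := hc.exists_infDist_eq_dist hne z
    refine ⟨y, hy, fun w hw => ?_⟩
    rw [← dist_eq_norm, ← dist_eq_norm, dist_comm, ← hmin, dist_comm]
    exact Metric.infDist_le_dist_of_mem hw
  choose π hπ using hex
  have hlip : LipschitzWith 1 π := LipschitzWith.of_dist_le_mul fun a b => by
    rw [dist_eq_norm, dist_eq_norm, NNReal.coe_one, one_mul]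
    exact (hπ a).norm_sub_le hS (hπ b)
  have : Y = π ∘ Z := by
    funext ω
    have := (h ω).norm_sub_le hS (hπ (Z ω))
    rw [sub_self, norm_zero] at this
    exact sub_eq_zero.1 (norm_le_zero_iff.1 this)
  rw [this]
  exact hlip.continuous.measurable.comp hZ

end Projection

theorem integral_mul_eq_of_condExp {Ω : Type*} {m mΩ : MeasurableSpace Ω} {P : Measure Ω}
    [IsProbabilityMeasure P] (hm : m ≤ mΩ) {φ o g : Ω → ℝ} (hφ : Measurable[m] φ)
    (ho : Integrable o P) {C : ℝ} (hC : ∀ᵐ ω ∂P, ‖φ ω‖ ≤ C) (hg : P[o | m] =ᵐ[P] g) :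
    ∫ ω, o ω * φ ω ∂P = ∫ ω, g ω * φ ω ∂P := by
  have hpull := condExp_stronglyMeasurable_mul_of_bound hm hφ.stronglyMeasurable ho C hC
  calc ∫ ω, o ω * φ ω ∂P = ∫ ω, (φ * o) ω ∂P := by simp only [Pi.mul_apply, mul_comm]
    _ = ∫ ω, (P[φ * o | m]) ω ∂P := (integral_condExp hm).symm
    _ = ∫ ω, g ω * φ ω ∂P := by
        refine integral_congr_ae ?_
        filter_upwards [hpull, hg] with ω h1 h2
        rw [h1, Pi.mul_apply, h2, mul_comm]

section Run

variable {Ω : Type*} [MeasurableSpace Ω] {P : Measure Ω} {d : ℕ}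
  {S : Set (EuclideanSpace ℝ (Fin d))} {f : EuclideanSpace ℝ (Fin d) → ℝ} {ρ : ℝ → ℝ}
  {η γ : ℝ} {T : ℕ} {x u : ℕ → Ω → EuclideanSpace ℝ (Fin d)} {o : ℕ → Ω → ℝ}

theorem IsRGDRun.mem (h : IsRGDRun P S f ρ η γ T x u o) {t : ℕ} (ht : t ≤ T) (ω : Ω) :
    x t ω ∈ S := by
  cases t with
  | zero => exact h.init_mem ω
  | succ t => exact (h.update t ht ω).1

theorem IsRGDRun.measurable (h : IsRGDRun P S f ρ η γ T x u o) (hS : Convex ℝ S)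
    (hc : IsClosed S) (hne : S.Nonempty) {t : ℕ} (ht : t ≤ T) : Measurable (x t) := by
  induction t with
  | zero => exact h.measurable_init
  | succ t ih =>
    refine measurable_of_isProjection hS hc hne ?_ (h.update t ht)
    have h1 := ih (by omega)
    have h2 := h.measurable_dir t ht
    have h3 := h.measurable_answer t ht
    fun_prop

theorem IsRGDRun.history_le (h : IsRGDRun P S f ρ η γ T x u o) (hS : Convex ℝ S)
    (hc : IsClosed S) (hne : S.Nonempty) {t : ℕ} (ht : t < T) :
    rgdHistory x u o t ≤ ‹MeasurableSpace Ω› := by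
  refine sup_le (h.measurable hS hc hne ht.le).comap_le (iSup_le fun s => ?_)
  have hs : (s : ℕ) < T := s.2.trans ht
  exact sup_le (sup_le (h.measurable hS hc hne hs.le).comap_le (h.measurable_dir s hs).comap_le)
    (h.measurable_answer s hs).comap_le

theorem IsRGDRun.ae_norm_dir (h : IsRGDRun P S f ρ η γ T x u o) {t : ℕ} (ht : t < T) :
    ∀ᵐ ω ∂P, ‖u t ω‖ = 1 := by
  have := ae_norm_eq_one_unifSphere d
  rw [← h.dir_law t ht] at this
  exact ae_of_ae_map (h.measurable_dir t ht).aemeasurable this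

variable [IsProbabilityMeasure P] {α β c p r G R : ℝ} {w : EuclideanSpace ℝ (Fin d)}

/-- Mean drift of one round of a run. -/
theorem IsRGDRun.le_integral_answer_mul_inner (hprob : IsDuelProblem S f ρ α β c p r G w)
    (hR : 0 < R) (hG : duelStep α β R d ≤ G)
    (h : IsRGDRun P S f ρ η (duelStep α β R d) T x u o) {t : ℕ} (ht : t < T) :
    2 * (epochB α β c p d * R ^ (2 * p)) / R * ∫ ω, ballExcess w (R / 16) (x t ω) ^ 2 ∂P ≤
      ∫ ω, o t ω * inner ℝ (u t ω) (ballExcessVec w (R / 16) (x t ω)) ∂P := by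
  have hne : S.Nonempty := ⟨w, hprob.mem⟩
  have hxm := h.measurable hprob.convex hprob.closed hne ht.le
  have hum := h.measurable_dir t ht
  have hom := h.measurable_answer t ht
  have hhist := h.history_le hprob.convex hprob.closed hne ht
  have hunit := h.ae_norm_dir ht
  have ha : 0 ≤ R / 16 := by positivity
  have hγ := duelStep_pos hprob.one_le_dim hprob.α_pos hprob.β_pos hR
  set γ := duelStep α β R d
  set q := ballExcessVec w (R / 16) with hq
  have hqm : Measurable q := measurable_ballExcessVec w (R / 16)
  set M := Metric.diam S
  have hqM : ∀ y ∈ S, ‖q y‖ ≤ M := fun y hy => by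
    rw [hq, norm_ballExcessVec ha]
    exact (ballExcess_le ha y).trans (hprob.norm_sub_le_diam hy)
  have hφM : ∀ᵐ ω ∂P, ‖(inner ℝ (u t ω) (q (x t ω)) : ℝ)‖ ≤ M := by
    filter_upwards [hunit] with ω hω
    refine (norm_inner_le_norm (𝕜 := ℝ) _ _).trans ?_
    rw [hω, one_mul]
    exact hqM _ (h.mem ht.le ω)
  have hφm : Measurable fun ω => (inner ℝ (u t ω) (q (x t ω)) : ℝ) :=
    hum.inner (hqm.comp hxm)
  have hφmm : Measurable[rgdHistory x u o t ⊔ MeasurableSpace.comap (u t) inferInstance]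
      fun ω => (inner ℝ (u t ω) (q (x t ω)) : ℝ) :=
    Measurable.inner ((comap_measurable (u t)).mono le_sup_right le_rfl)
      (hqm.comp ((comap_measurable (x t)).mono (le_sup_left.trans le_sup_left) le_rfl))
  have hoint : Integrable (o t) P := by
    refine Integrable.of_bound hom.aestronglyMeasurable 1 ?_
    filter_upwards [h.answer_sign t ht] with ω hω
    rcases hω with hω | hω <;> simp [hω]
  set Ψ : EuclideanSpace ℝ (Fin d) × EuclideanSpace ℝ (Fin d) → ℝ := fun z =>
    ρ (queryValue S G f (z.1 + γ • z.2) - queryValue S G f (z.1 - γ • z.2)) *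
      inner ℝ z.2 (q z.1) with hΨ
  have hfm := hprob.measurable_queryValue
  have hρm : Measurable ρ := hprob.transfer.differentiable.continuous.measurable
  have hΨm : Measurable Ψ :=
    (hρm.comp ((hfm.comp (by fun_prop)).sub (hfm.comp (by fun_prop)))).mul
      (measurable_snd.inner (hqm.comp measurable_fst))
  have hcond : ∫ ω, o t ω * inner ℝ (u t ω) (q (x t ω)) ∂P = ∫ ω, Ψ (x t ω, u t ω) ∂P := by
    rw [integral_mul_eq_of_condExp (sup_le hhist hum.comap_le) hφmm hoint hφM
      (h.answer_mean t ht)]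
    refine integral_congr_ae ?_
    filter_upwards [hunit] with ω h3
    have hγu : ‖γ • u t ω‖ ≤ G := by
      rw [norm_smul, h3, Real.norm_of_nonneg hγ.le, mul_one]; exact hG
    simp only [hΨ, queryValue_add (h.mem ht.le ω) hγu, queryValue_sub (h.mem ht.le ω) hγu]
  have hindep : IndepFun (x t) (u t) P := by
    rw [IndepFun_iff_Indep]
    exact (indep_of_indep_of_le_right (h.dir_indep t ht) le_sup_left).symm
  have hlaw := (indepFun_iff_map_prod_eq_prod_map_map hxm.aemeasurable hum.aemeasurable).1 hindep
  rw [h.dir_law t ht] at hlaw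
  have hpair : Measurable fun ω => (x t ω, u t ω) := hxm.prodMk hum
  have hΨint : Integrable (fun ω => Ψ (x t ω, u t ω)) P := by
    refine Integrable.of_bound (hΨm.comp hpair).aestronglyMeasurable M ?_
    filter_upwards [hφM] with ω hω
    rw [hΨ, norm_mul]
    calc _ ≤ 1 * M := by
          gcongr
          exact hprob.transfer.abs_le_one _
      _ = M := one_mul M
  have := isProbabilityMeasure_unifSphere hprob.one_le_dim
  have : IsProbabilityMeasure (P.map (x t)) := Measure.isProbabilityMeasure_map hxm.aemeasurable
  have hΨprod : Integrable Ψ ((P.map (x t)).prod (unifSphere d)) := by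
    rw [← hlaw, integrable_map_measure hΨm.aestronglyMeasurable hpair.aemeasurable]
    exact hΨint
  have hfub : ∫ ω, Ψ (x t ω, u t ω) ∂P =
      ∫ y, ∫ v, Ψ (y, v) ∂(unifSphere d) ∂(P.map (x t)) := by
    rw [← integral_prod Ψ hΨprod, ← hlaw, integral_map hpair.aemeasurable
      hΨm.aestronglyMeasurable]
  have hδm := measurable_ballExcess w (R / 16)
  have hδint : Integrable (fun y => ballExcess w (R / 16) y ^ 2) (P.map (x t)) := by
    rw [integrable_map_measure (hδm.pow_const 2).aestronglyMeasurable hxm.aemeasurable]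
    refine Integrable.of_bound ((hδm.pow_const 2).comp hxm).aestronglyMeasurable (M ^ 2) ?_
    refine Filter.Eventually.of_forall fun ω => ?_
    rw [Function.comp, norm_pow, Real.norm_of_nonneg (ballExcess_nonneg _ _ _)]
    exact pow_le_pow_left₀ (ballExcess_nonneg _ _ _)
      ((ballExcess_le ha _).trans (hprob.norm_sub_le_diam (h.mem ht.le ω))) 2
  have hmemS : ∀ᵐ y ∂(P.map (x t)), y ∈ S :=
    (ae_map_iff hxm.aemeasurable hprob.closed.measurableSet).2
      (Filter.Eventually.of_forall fun ω => h.mem ht.le ω)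
  rw [hcond, hfub, ← integral_map hxm.aemeasurable
    (f := fun y => ballExcess w (R / 16) y ^ 2) (hδm.pow_const 2).aestronglyMeasurable,
    ← integral_const_mul]
  refine integral_mono_ae (hδint.const_mul _) hΨprod.integral_prod_left ?_
  filter_upwards [hmemS] with y hy
  have := hprob.le_integral_drift hR hG hy
  rw [mul_div_right_comm] at this
  exact this

theorem IsRGDRun.integrable_comp (hprob : IsDuelProblem S f ρ α β c p r G w)
    (h : IsRGDRun P S f ρ η γ T x u o) {t : ℕ} (ht : t ≤ T)
    {F : EuclideanSpace ℝ (Fin d) → ℝ} (hF : Measurable F) {C : ℝ} (hC : ∀ y ∈ S, |F y| ≤ C) :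
    Integrable (fun ω => F (x t ω)) P := by
  refine Integrable.of_bound
    (hF.comp (h.measurable hprob.convex hprob.closed ⟨w, hprob.mem⟩ ht)).aestronglyMeasurable C ?_
  exact Filter.Eventually.of_forall fun ω => hC _ (h.mem ht ω)

theorem IsDuelProblem.ballExcess_sq_le (hprob : IsDuelProblem S f ρ α β c p r G w) {a : ℝ}
    (ha : 0 ≤ a) : ∀ y ∈ S, |ballExcess w a y ^ 2| ≤ Metric.diam S ^ 2 := fun y hy => by
  rw [abs_pow, abs_of_nonneg (ballExcess_nonneg _ _ _)]
  exact pow_le_pow_left₀ (ballExcess_nonneg _ _ _)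
    ((ballExcess_le ha _).trans (hprob.norm_sub_le_diam hy)) 2

/-- One round contracts the mean squared distance to the ball of radius `R / 16`, up to the
squared learning rate. -/
theorem IsRGDRun.integral_ballExcess_succ_le (hprob : IsDuelProblem S f ρ α β c p r G w)
    (hR : 0 < R) (hG : duelStep α β R d ≤ G)
    (h : IsRGDRun P S f ρ (epochB α β c p d * R ^ (2 * p) * R) (duelStep α β R d) T x u o)
    {t : ℕ} (ht : t < T) :
    ∫ ω, ballExcess w (R / 16) (x (t + 1) ω) ^ 2 ∂P ≤
      (1 - 4 * (epochB α β c p d * R ^ (2 * p)) ^ 2) *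
        ∫ ω, ballExcess w (R / 16) (x t ω) ^ 2 ∂P +
      (epochB α β c p d * R ^ (2 * p)) ^ 2 * R ^ 2 := by
  have hdrift := h.le_integral_answer_mul_inner hprob hR hG ht
  have ha : 0 ≤ R / 16 := by positivity
  have hδm := (measurable_ballExcess w (R / 16)).pow_const 2
  have hbound := hprob.ballExcess_sq_le ha
  have hi0 := h.integrable_comp hprob ht.le hδm hbound
  have hi1 := h.integrable_comp hprob (t := t + 1) ht hδm hbound
  have hB : 0 ≤ epochB α β c p d * R ^ (2 * p) :=
    mul_nonneg (epochB_pos hprob.one_le_dim hprob.α_pos hprob.β_pos hprob.transfer.c_pos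
      hprob.transfer.one_le_p).le (Real.rpow_nonneg hR.le _)
  set b := epochB α β c p d * R ^ (2 * p)
  have hxm := h.measurable hprob.convex hprob.closed ⟨w, hprob.mem⟩ ht.le
  have hum := h.measurable_dir t ht
  have hom := h.measurable_answer t ht
  have hi2 : Integrable
      (fun ω => o t ω * inner ℝ (u t ω) (ballExcessVec w (R / 16) (x t ω))) P := by
    refine Integrable.of_bound (hom.mul
      (hum.inner ((measurable_ballExcessVec w (R / 16)).comp hxm))).aestronglyMeasurable
      (Metric.diam S) ?_
    filter_upwards [h.answer_sign t ht, h.ae_norm_dir ht] with ω h1 h2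
    have h3 : ‖o t ω‖ = 1 := by rcases h1 with h1 | h1 <;> simp [h1]
    rw [norm_mul, h3, one_mul]
    refine (norm_inner_le_norm (𝕜 := ℝ) _ _).trans ?_
    rw [h2, one_mul, norm_ballExcessVec ha]
    exact (ballExcess_le ha _).trans (hprob.norm_sub_le_diam (h.mem ht.le ω))
  have hstep : ∀ᵐ ω ∂P, ballExcess w (R / 16) (x (t + 1) ω) ^ 2 ≤
      ballExcess w (R / 16) (x t ω) ^ 2 - 2 * (b * R) *
        (o t ω * inner ℝ (u t ω) (ballExcessVec w (R / 16) (x t ω))) + (b * R) ^ 2 := by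
    filter_upwards [h.answer_sign t ht, h.ae_norm_dir ht] with ω h1 h2
    have h3 : o t ω ^ 2 = 1 := by rcases h1 with h1 | h1 <;> simp [h1]
    have hQ := sub_ballExcessVec_mem hprob.convex hprob.mem (h.mem ht.le ω) ha
    have h4 := (ballExcess_le_norm_sub ha (x t ω) (x (t + 1) ω)).trans
      ((h.update t ht ω).norm_sub_le hprob.convex (isProjection_self hQ))
    have e : x t ω - (b * R) • (o t ω • u t ω) - (x t ω - ballExcessVec w (R / 16) (x t ω)) =
        ballExcessVec w (R / 16) (x t ω) - (b * R * o t ω) • u t ω := by module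
    rw [e] at h4
    refine (pow_le_pow_left₀ (ballExcess_nonneg _ _ _) h4 2).trans (le_of_eq ?_)
    rw [norm_sub_sq_real, norm_ballExcessVec ha, inner_smul_right, norm_smul, h2, mul_one,
      Real.norm_eq_abs, sq_abs, mul_pow, h3, real_inner_comm]
    ring
  have hR' : R ≠ 0 := hR.ne'
  calc ∫ ω, ballExcess w (R / 16) (x (t + 1) ω) ^ 2 ∂P
      ≤ ∫ ω, (ballExcess w (R / 16) (x t ω) ^ 2 - 2 * (b * R) *
        (o t ω * inner ℝ (u t ω) (ballExcessVec w (R / 16) (x t ω))) + (b * R) ^ 2) ∂P :=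
        integral_mono_ae hi1 ((hi0.sub (hi2.const_mul _)).add (integrable_const _)) hstep
    _ = ∫ ω, ballExcess w (R / 16) (x t ω) ^ 2 ∂P - 2 * (b * R) *
        ∫ ω, o t ω * inner ℝ (u t ω) (ballExcessVec w (R / 16) (x t ω)) ∂P + (b * R) ^ 2 := by
        have hi3 := hi2.const_mul (2 * (b * R))
        have hi4 : Integrable (fun ω => ballExcess w (R / 16) (x t ω) ^ 2 - 2 * (b * R) *
            (o t ω * inner ℝ (u t ω) (ballExcessVec w (R / 16) (x t ω)))) P := hi0.sub hi3
        rw [integral_add hi4 (integrable_const _), integral_sub hi0 hi3, integral_const_mul]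
        simp
    _ ≤ ∫ ω, ballExcess w (R / 16) (x t ω) ^ 2 ∂P - 2 * (b * R) *
        (2 * b / R * ∫ ω, ballExcess w (R / 16) (x t ω) ^ 2 ∂P) + (b * R) ^ 2 := by
        gcongr
    _ = _ := by field_simp; ring

end Run

theorem le_half_of_contraction {a : ℕ → ℝ} {b A : ℝ} {T : ℕ} (ha : ∀ t, 0 ≤ a t) (hA : 0 ≤ A)
    (hb : 0 < b) (hb2 : b ^ 2 ≤ 1 / 2) (hT : 1 / (2 * b ^ 2) ≤ T) (h0 : a 0 ≤ A)
    (hstep : ∀ t < T, a (t + 1) ≤ (1 - 4 * b ^ 2) * a t + b ^ 2 * A) : a T ≤ A / 2 := by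
  rcases le_total (4 * b ^ 2) 1 with h | h
  · have hind : ∀ t ≤ T, a t ≤ A / 4 + (1 - 4 * b ^ 2) ^ t * (3 / 4 * A) := by
      intro t
      induction t with
      | zero => intro _; linarith
      | succ t ih =>
        intro ht
        have h1 := mul_le_mul_of_nonneg_left (ih (by omega)) (sub_nonneg.2 h)
        have h2 := hstep t (by omega)
        rw [pow_succ]
        linarith
    have h1 := hind T le_rfl
    have h2 : (1 - 4 * b ^ 2) ^ T ≤ 1 / 5 := by
      have e1 : 1 - 4 * b ^ 2 ≤ Real.exp (-(4 * b ^ 2)) := by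
        linarith [Real.add_one_le_exp (-(4 * b ^ 2))]
      calc (1 - 4 * b ^ 2) ^ T ≤ Real.exp (-(4 * b ^ 2)) ^ T :=
            pow_le_pow_left₀ (sub_nonneg.2 h) e1 T
        _ = Real.exp (T * -(4 * b ^ 2)) := by rw [← Real.exp_nat_mul]
        _ ≤ Real.exp (-1 + -1) := by
            rw [Real.exp_le_exp]
            rw [div_le_iff₀ (by positivity)] at hT
            linarith
        _ ≤ 1 / 5 := by
            rw [Real.exp_add]
            have := Real.exp_neg_one_lt_d9
            have := Real.exp_pos (-1)
            nlinarith
    have h3 := mul_le_mul_of_nonneg_right h2 (show 0 ≤ 3 / 4 * A by positivity)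
    linarith
  · have hT0 : 0 < T := by
      have : (0 : ℝ) < T := lt_of_lt_of_le (by positivity) hT
      exact_mod_cast this
    obtain ⟨t, rfl⟩ := Nat.exists_eq_succ_of_ne_zero hT0.ne'
    have h1 := hstep t (Nat.lt_succ_self t)
    have h2 : (1 - 4 * b ^ 2) * a t ≤ 0 := mul_nonpos_of_nonpos_of_nonneg (by linarith) (ha t)
    have h3 : b ^ 2 * A ≤ 1 / 2 * A := by gcongr
    linarith

theorem sq_rpow_two_mul {R p : ℝ} (hR : 0 ≤ R) : (R ^ 2) ^ (2 * p) = (R ^ (2 * p)) ^ 2 := by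
  rw [← Real.rpow_natCast, ← Real.rpow_natCast, ← Real.rpow_mul hR, ← Real.rpow_mul hR, mul_comm]

section Epoch

variable {Ω : Type*} [MeasurableSpace Ω] {P : Measure Ω} [IsProbabilityMeasure P] {d : ℕ}
  {S : Set (EuclideanSpace ℝ (Fin d))} {f : EuclideanSpace ℝ (Fin d) → ℝ} {ρ : ℝ → ℝ}
  {α β c p r G R : ℝ} {w : EuclideanSpace ℝ (Fin d)}
  {x u : ℕ → Ω → EuclideanSpace ℝ (Fin d)} {o : ℕ → Ω → ℝ}

/-- One epoch shrinks the mean squared distance to the minimizer from `R ^ 2` to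
`3 / 4 * R ^ 2`. -/
theorem IsRGDRun.integral_norm_sq_le (hprob : IsDuelProblem S f ρ α β c p r G w)
    (hR : 0 < R) (hG : duelStep α β R d ≤ G)
    (h : IsRGDRun P S f ρ (epochB α β c p d * R ^ (2 * p + 1)) (duelStep α β R d)
      ⌈1 / (2 * epochB α β c p d ^ 2 * (R ^ 2) ^ (2 * p))⌉₊ x u o)
    (h0 : ∫ ω, ‖x 0 ω - w‖ ^ 2 ∂P ≤ R ^ 2) :
    ∫ ω, ‖x ⌈1 / (2 * epochB α β c p d ^ 2 * (R ^ 2) ^ (2 * p))⌉₊ ω - w‖ ^ 2 ∂P ≤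
      3 / 4 * R ^ 2 := by
  rw [sq_rpow_two_mul hR.le, mul_assoc, ← mul_pow] at h ⊢
  rw [Real.rpow_add_one hR.ne', ← mul_assoc] at h
  have hb : 0 < epochB α β c p d * R ^ (2 * p) :=
    mul_pos (epochB_pos hprob.one_le_dim hprob.α_pos hprob.β_pos hprob.transfer.c_pos
      hprob.transfer.one_le_p) (Real.rpow_pos_of_pos hR _)
  have hfar' := fun (y : EuclideanSpace ℝ (Fin d)) (hy : y ∈ S) (hl : R / 4 ≤ ‖y - w‖) =>
    hprob.epochB_mul_le hR hG hy hl
  have hstep' := fun t ht => h.integral_ballExcess_succ_le hprob hR hG (t := t) ht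
  have hT := Nat.le_ceil (1 / (2 * (epochB α β c p d * R ^ (2 * p)) ^ 2))
  set b := epochB α β c p d * R ^ (2 * p)
  set T := ⌈1 / (2 * b ^ 2)⌉₊
  have hnorm : ∀ y ∈ S, |‖y - w‖ ^ 2| ≤ Metric.diam S ^ 2 := fun y hy => by
    rw [abs_pow, abs_norm]
    exact pow_le_pow_left₀ (norm_nonneg _) (hprob.norm_sub_le_diam hy) 2
  have hnm : Measurable fun y : EuclideanSpace ℝ (Fin d) => ‖y - w‖ ^ 2 := by fun_prop
  by_cases hfar : ∃ y ∈ S, 3 / 4 * R ^ 2 < ‖y - w‖ ^ 2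
  · obtain ⟨y, hy, hyl⟩ := hfar
    have hl : R / 4 ≤ ‖y - w‖ := by
      refine (abs_le_of_sq_le_sq' ?_ (norm_nonneg _)).2
      nlinarith [sq_nonneg R]
    have hb2 : b ^ 2 ≤ 1 / 2 := by
      have h1 := hfar' y hy hl
      have h2 : (b * (193 / 100 * ‖y - w‖)) ^ 2 ≤ R ^ 2 := pow_le_pow_left₀ (by positivity) h1 2
      have h3 : b ^ 2 * (3 / 4 * R ^ 2) ≤ b ^ 2 * ‖y - w‖ ^ 2 := by gcongr
      have h4 : b ^ 2 * R ^ 2 ≤ 1 / 2 * R ^ 2 := by nlinarith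
      exact le_of_mul_le_mul_right h4 (by positivity)
    have ha : 0 ≤ R / 16 := by positivity
    have hδm := (measurable_ballExcess w (R / 16)).pow_const 2
    have hbound := hprob.ballExcess_sq_le ha
    have hlast := le_half_of_contraction
      (a := fun t => ∫ ω, ballExcess w (R / 16) (x t ω) ^ 2 ∂P) (A := R ^ 2)
      (fun t => integral_nonneg fun ω => sq_nonneg _) (sq_nonneg R) hb hb2 hT
      (le_trans (integral_mono (h.integrable_comp hprob (Nat.zero_le _) hδm hbound)
        (h.integrable_comp hprob (Nat.zero_le _) hnm hnorm)
        fun ω => pow_le_pow_left₀ (ballExcess_nonneg _ _ _) (ballExcess_le ha _) 2) h0) hstep'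
    have hi := h.integrable_comp hprob le_rfl hδm hbound
    calc ∫ ω, ‖x T ω - w‖ ^ 2 ∂P
        ≤ ∫ ω, (11 / 10 * ballExcess w (R / 16) (x T ω) ^ 2 + 11 / 256 * R ^ 2) ∂P := by
          refine integral_mono (h.integrable_comp hprob le_rfl hnm hnorm)
            ((hi.const_mul _).add (integrable_const _)) fun ω => ?_
          have h1 := pow_le_pow_left₀ (norm_nonneg _)
            (norm_sub_le_ballExcess_add w (R / 16) (x T ω)) 2
          simp only
          nlinarith [sq_nonneg (ballExcess w (R / 16) (x T ω) - 10 * (R / 16))]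
      _ = 11 / 10 * ∫ ω, ballExcess w (R / 16) (x T ω) ^ 2 ∂P + 11 / 256 * R ^ 2 := by
          rw [integral_add (hi.const_mul _) (integrable_const _), integral_const_mul]
          simp
      _ ≤ 3 / 4 * R ^ 2 := by nlinarith [sq_nonneg R]
  · push Not at hfar
    calc ∫ ω, ‖x T ω - w‖ ^ 2 ∂P ≤ ∫ _, 3 / 4 * R ^ 2 ∂P :=
          integral_mono (h.integrable_comp hprob le_rfl hnm hnorm) (integrable_const _)
            fun ω => hfar _ (h.mem le_rfl ω)
      _ = _ := by simp

end Epoch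

theorem epochRadius_pos {D : ℝ} (hD : 0 < D) (k : ℕ) : 0 < epochRadius D k := by
  induction k with
  | zero => exact hD
  | succ k ih => exact mul_pos (by positivity) ih

theorem epochRadius_sq (D : ℝ) (k : ℕ) : epochRadius D k ^ 2 = (3 / 4 : ℝ) ^ k * D ^ 2 := by
  induction k with
  | zero => simp [epochRadius]
  | succ k ih =>
    rw [epochRadius, mul_pow, ih, Real.sq_sqrt (by norm_num), pow_succ]
    ring

theorem epochRadius_le {D : ℝ} (hD : 0 < D) (k : ℕ) : epochRadius D k ≤ D := by
  refine (abs_le_of_sq_le_sq' ?_ hD.le).2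
  rw [epochRadius_sq]
  exact mul_le_of_le_one_left (sq_nonneg D) (pow_le_one₀ (by norm_num) (by norm_num))

theorem mul_le_of_epochCount_le {β D ε : ℝ} (hβ : 0 < β) (hD : 0 < D) (hε : 0 < ε) :
    β / 2 * ((3 / 4 : ℝ) ^ epochCount β D ε * D ^ 2) ≤ ε := by
  have h1 : Real.logb (4 / 3) (β * D ^ 2 / (2 * ε)) ≤ epochCount β D ε := Nat.le_ceil _
  rw [Real.logb_le_iff_le_rpow (by norm_num) (by positivity), Real.rpow_natCast,
    div_le_iff₀ (by positivity)] at h1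
  have h2 : (3 / 4 : ℝ) ^ epochCount β D ε * (4 / 3) ^ epochCount β D ε = 1 := by
    rw [← mul_pow]; norm_num
  have h3 : (0 : ℝ) < (3 / 4) ^ epochCount β D ε := by positivity
  calc β / 2 * ((3 / 4 : ℝ) ^ epochCount β D ε * D ^ 2)
      = (3 / 4 : ℝ) ^ epochCount β D ε * (β * D ^ 2) / 2 := by ring
    _ ≤ (3 / 4 : ℝ) ^ epochCount β D ε * ((4 / 3) ^ epochCount β D ε * (2 * ε)) / 2 := by gcongr
    _ = ((3 / 4 : ℝ) ^ epochCount β D ε * (4 / 3) ^ epochCount β D ε) * ε := by ring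
    _ = ε := by rw [h2, one_mul]

theorem le_mul_of_lt_epochCount {β D ε : ℝ} (hβ : 0 < β) (hD : 0 < D) (hε : 0 < ε) {k : ℕ}
    (hk : k < epochCount β D ε) : 2 * ε / β ≤ (3 / 4 : ℝ) ^ k * D ^ 2 := by
  have h1 : (k : ℝ) < Real.logb (4 / 3) (β * D ^ 2 / (2 * ε)) := Nat.lt_ceil.1 hk
  rw [Real.lt_logb_iff_rpow_lt (by norm_num) (by positivity), Real.rpow_natCast,
    lt_div_iff₀ (by positivity)] at h1
  have h2 : (3 / 4 : ℝ) ^ k * (4 / 3) ^ k = 1 := by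
    rw [← mul_pow]; norm_num
  rw [div_le_iff₀ hβ]
  calc 2 * ε = (3 / 4 : ℝ) ^ k * ((4 / 3) ^ k * (2 * ε)) := by rw [← mul_assoc, h2, one_mul]
    _ ≤ (3 / 4 : ℝ) ^ k * (β * D ^ 2) := by gcongr
    _ = _ := by ring

theorem sum_three_quarters_pow_le (n : ℕ) : ∑ j ∈ Finset.range n, (3 / 4 : ℝ) ^ j ≤ 4 := by
  have : ∑ j ∈ Finset.range n, (3 / 4 : ℝ) ^ j = 4 * (1 - (3 / 4) ^ n) := by
    rw [geom_sum_eq (by norm_num)]; ring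
  rw [this]
  have : (0 : ℝ) ≤ (3 / 4) ^ n := by positivity
  linarith

section Queries

variable {d : ℕ} {S : Set (EuclideanSpace ℝ (Fin d))} {f : EuclideanSpace ℝ (Fin d) → ℝ}
  {ρ : ℝ → ℝ} {α β c p r : ℝ} {w : EuclideanSpace ℝ (Fin d)} {ε : ℝ}

theorem IsDuelProblem.epochB_mul_diam_le
    (h : IsDuelProblem S f ρ α β c p r (epochGamma α β d (Metric.diam S) 0) w) :
    epochB α β c p d * Metric.diam S ^ (2 * p) ≤ 21 / 10 := by
  have hD := h.diam_pos
  have hex : ∃ x ∈ S, Metric.diam S / 4 ≤ ‖x - w‖ := by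
    by_contra! hlt
    have : Metric.diam S ≤ Metric.diam S / 2 := by
      refine Metric.diam_le_of_forall_dist_le (by positivity) fun x hx y hy => ?_
      have := dist_triangle_right x y w
      rw [dist_eq_norm x w, dist_eq_norm y w] at this
      linarith [hlt x hx, hlt y hy]
    linarith
  obtain ⟨x, hx, hl⟩ := hex
  have h1 := h.epochB_mul_le hD le_rfl hx hl
  have hB : 0 < epochB α β c p d * Metric.diam S ^ (2 * p) :=
    mul_pos (epochB_pos h.one_le_dim h.α_pos h.β_pos h.transfer.c_pos h.transfer.one_le_p)
      (Real.rpow_pos_of_pos hD _)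
  have h2 : epochB α β c p d * Metric.diam S ^ (2 * p) * (193 / 400) * Metric.diam S ≤
      1 * Metric.diam S := by
    have := mul_le_mul_of_nonneg_left hl hB.le
    linarith
  have h3 := le_of_mul_le_mul_right h2 hD
  linarith

theorem IsDuelProblem.epochBudget_le
    (h : IsDuelProblem S f ρ α β c p r (epochGamma α β d (Metric.diam S) 0) w) (k : ℕ) :
    (epochBudget α β c p d (Metric.diam S) k : ℝ) ≤
      5 / (epochB α β c p d ^ 2 * (epochRadius (Metric.diam S) k ^ 2) ^ (2 * p)) := by
  have hD := h.diam_pos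
  have hp := h.transfer.one_le_p
  have hB := epochB_pos h.one_le_dim h.α_pos h.β_pos h.transfer.c_pos hp
  have h1 := h.epochB_mul_diam_le
  have hRk := epochRadius_pos hD k
  have h2 : epochB α β c p d * epochRadius (Metric.diam S) k ^ (2 * p) ≤ 21 / 10 := by
    refine le_trans ?_ h1
    gcongr
    exact epochRadius_le hD k
  have hpos : 0 < epochB α β c p d * epochRadius (Metric.diam S) k ^ (2 * p) := by positivity
  have h3 := (Nat.ceil_lt_add_one (a := 1 / (2 * epochB α β c p d ^ 2 *
    (epochRadius (Metric.diam S) k ^ 2) ^ (2 * p))) (by positivity)).le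
  unfold epochBudget
  refine h3.trans ?_
  rw [sq_rpow_two_mul hRk.le, mul_assoc, ← mul_pow]
  set b := epochB α β c p d * epochRadius (Metric.diam S) k ^ (2 * p)
  rw [le_div_iff₀ (by positivity)]
  have e : (1 / (2 * b ^ 2) + 1) * b ^ 2 = 1 / 2 + b ^ 2 := by field_simp
  rw [e]
  nlinarith

theorem IsDuelProblem.epochQueries_le
    (h : IsDuelProblem S f ρ α β c p r (epochGamma α β d (Metric.diam S) 0) w) (hε : 0 < ε) :
    (epochQueries α β c p d (Metric.diam S) ε : ℝ) ≤
      20 * (β / 2) ^ (2 * p) / (epochB α β c p d ^ 2 * ε ^ (2 * p)) := by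
  have hD := h.diam_pos
  have hβ := h.β_pos
  have hp := h.transfer.one_le_p
  have hB := epochB_pos h.one_le_dim h.α_pos hβ h.transfer.c_pos hp
  set D := Metric.diam S
  set B := epochB α β c p d
  unfold epochQueries
  rcases hK : epochCount β D ε with _ | n
  · simp; positivity
  push_cast
  have hn := le_mul_of_lt_epochCount hβ hD hε (k := n) (by omega)
  set A := 5 / (B ^ 2 * (2 * ε / β) ^ (2 * p)) with hA
  have hA0 : 0 ≤ A := by positivity
  have hterm : ∀ k ∈ Finset.range (n + 1),
      (epochBudget α β c p d D k : ℝ) ≤ A * (3 / 4 : ℝ) ^ (n + 1 - 1 - k) := by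
    intro k hk
    rw [Finset.mem_range] at hk
    refine (h.epochBudget_le k).trans ?_
    rw [Nat.add_sub_cancel, hA, div_mul_eq_mul_div, div_le_div_iff₀
      (mul_pos (by positivity) (Real.rpow_pos_of_pos (pow_pos (epochRadius_pos hD k) 2) _))
      (by positivity)]
    have e1 : (3 / 4 : ℝ) ^ (n - k) * epochRadius D k ^ 2 = (3 / 4) ^ n * D ^ 2 := by
      rw [epochRadius_sq, ← mul_assoc, ← pow_add, Nat.sub_add_cancel (by omega)]
    have hq0 : (0 : ℝ) < (3 / 4) ^ (n - k) := by positivity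
    have hq1 : (3 / 4 : ℝ) ^ (n - k) ≤ 1 := pow_le_one₀ (by norm_num) (by norm_num)
    have e2 : (2 * ε / β) ^ (2 * p) ≤
        (3 / 4 : ℝ) ^ (n - k) * (epochRadius D k ^ 2) ^ (2 * p) := by
      calc (2 * ε / β) ^ (2 * p)
          ≤ ((3 / 4 : ℝ) ^ (n - k) * epochRadius D k ^ 2) ^ (2 * p) := by
            rw [e1]
            exact Real.rpow_le_rpow (by positivity) hn (by linarith)
        _ = ((3 / 4 : ℝ) ^ (n - k)) ^ (2 * p) * (epochRadius D k ^ 2) ^ (2 * p) :=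
            Real.mul_rpow hq0.le (sq_nonneg _)
        _ ≤ _ := by
            have := Real.rpow_le_rpow_of_exponent_ge hq0 hq1 (show 1 ≤ 2 * p by linarith)
            rw [Real.rpow_one] at this
            gcongr
    calc 5 * (B ^ 2 * (2 * ε / β) ^ (2 * p))
        ≤ 5 * (B ^ 2 * ((3 / 4 : ℝ) ^ (n - k) * (epochRadius D k ^ 2) ^ (2 * p))) := by gcongr
      _ = _ := by ring
  calc ∑ k ∈ Finset.range (n + 1), (epochBudget α β c p d D k : ℝ)
      ≤ ∑ k ∈ Finset.range (n + 1), A * (3 / 4 : ℝ) ^ (n + 1 - 1 - k) := Finset.sum_le_sum hterm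
    _ = A * ∑ j ∈ Finset.range (n + 1), (3 / 4 : ℝ) ^ j := by
        rw [← Finset.mul_sum, Finset.sum_range_reflect (fun j => (3 / 4 : ℝ) ^ j)]
    _ ≤ A * 4 := by
        gcongr
        exact sum_three_quarters_pow_le _
    _ = _ := by
        have e3 : (2 * ε / β) ^ (2 * p) * (β / 2) ^ (2 * p) = ε ^ (2 * p) := by
          rw [← Real.mul_rpow (by positivity) (by positivity)]
          congr 1
          field_simp
        have hx : (2 * ε / β) ^ (2 * p) ≠ 0 := by positivity
        have hy : (β / 2) ^ (2 * p) ≠ 0 := by positivity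
        rw [hA, ← e3]
        field_simp
        norm_num

end Queries

section EpochRun

variable {Ω : Type*} [MeasurableSpace Ω] {P : Measure Ω} {d : ℕ}
  {S : Set (EuclideanSpace ℝ (Fin d))} {f : EuclideanSpace ℝ (Fin d) → ℝ} {ρ : ℝ → ℝ}
  {α β c p r ε : ℝ} {wstar w₁ : EuclideanSpace ℝ (Fin d)}
  {w : ℕ → Ω → EuclideanSpace ℝ (Fin d)}
  {x u : ℕ → ℕ → Ω → EuclideanSpace ℝ (Fin d)} {o : ℕ → ℕ → Ω → ℝ}

theorem IsEpochRGDRun.measurable_and_mem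
    (hprob : IsDuelProblem S f ρ α β c p r (epochGamma α β d (Metric.diam S) 0) wstar)
    (h : IsEpochRGDRun P S f ρ α β c p (Metric.diam S) ε w₁ w x u o) {k : ℕ}
    (hk : k ≤ epochCount β (Metric.diam S) ε) : Measurable (w k) ∧ ∀ ω, w k ω ∈ S := by
  cases k with
  | zero =>
    have : w 0 = fun _ => w₁ := funext h.init
    rw [this]
    exact ⟨measurable_const, fun _ => h.init_mem⟩
  | succ k =>
    rw [h.next k hk]
    exact ⟨(h.run k hk).measurable hprob.convex hprob.closed ⟨_, hprob.mem⟩ le_rfl,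
      (h.run k hk).mem le_rfl⟩

variable [IsProbabilityMeasure P]

theorem IsEpochRGDRun.integrable_comp
    (hprob : IsDuelProblem S f ρ α β c p r (epochGamma α β d (Metric.diam S) 0) wstar)
    (h : IsEpochRGDRun P S f ρ α β c p (Metric.diam S) ε w₁ w x u o) {k : ℕ}
    (hk : k ≤ epochCount β (Metric.diam S) ε) {F : EuclideanSpace ℝ (Fin d) → ℝ}
    (hF : Measurable F) {C : ℝ} (hC : ∀ y ∈ S, |F y| ≤ C) :
    Integrable (fun ω => F (w k ω)) P := by
  obtain ⟨hm, hS⟩ := h.measurable_and_mem hprob hk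
  exact Integrable.of_bound (hF.comp hm).aestronglyMeasurable C
    (Filter.Eventually.of_forall fun ω => hC _ (hS ω))

theorem IsEpochRGDRun.integrable_norm_sq
    (hprob : IsDuelProblem S f ρ α β c p r (epochGamma α β d (Metric.diam S) 0) wstar)
    (h : IsEpochRGDRun P S f ρ α β c p (Metric.diam S) ε w₁ w x u o) {k : ℕ}
    (hk : k ≤ epochCount β (Metric.diam S) ε) :
    Integrable (fun ω => ‖w k ω - wstar‖ ^ 2) P := by
  refine h.integrable_comp hprob hk (F := fun y => ‖y - wstar‖ ^ 2) (by fun_prop)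
    (C := Metric.diam S ^ 2) fun y hy => ?_
  rw [abs_pow, abs_norm]
  exact pow_le_pow_left₀ (norm_nonneg _) (hprob.norm_sub_le_diam hy) 2

theorem IsEpochRGDRun.integral_norm_sq_succ_le
    (hprob : IsDuelProblem S f ρ α β c p r (epochGamma α β d (Metric.diam S) 0) wstar)
    (h : IsEpochRGDRun P S f ρ α β c p (Metric.diam S) ε w₁ w x u o) {k : ℕ}
    (hk : k < epochCount β (Metric.diam S) ε)
    (h0 : ∫ ω, ‖w k ω - wstar‖ ^ 2 ∂P ≤ epochRadius (Metric.diam S) k ^ 2) :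
    ∫ ω, ‖w (k + 1) ω - wstar‖ ^ 2 ∂P ≤ 3 / 4 * epochRadius (Metric.diam S) k ^ 2 := by
  have hD := hprob.diam_pos
  rw [h.next k hk]
  rw [← h.start k hk] at h0
  exact (h.run k hk).integral_norm_sq_le hprob (epochRadius_pos hD k)
    (duelStep_mono hprob.α_pos hprob.β_pos (epochRadius_le hD k)) h0

theorem IsEpochRGDRun.integral_norm_sq_le
    (hprob : IsDuelProblem S f ρ α β c p r (epochGamma α β d (Metric.diam S) 0) wstar)
    (h : IsEpochRGDRun P S f ρ α β c p (Metric.diam S) ε w₁ w x u o) {k : ℕ}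
    (hk : k ≤ epochCount β (Metric.diam S) ε) :
    ∫ ω, ‖w k ω - wstar‖ ^ 2 ∂P ≤ epochRadius (Metric.diam S) k ^ 2 := by
  induction k with
  | zero =>
    simp only [h.init, epochRadius, integral_const, probReal_univ, one_smul]
    exact pow_le_pow_left₀ (norm_nonneg _) (hprob.norm_sub_le_diam h.init_mem) 2
  | succ k ih =>
    refine (h.integral_norm_sq_succ_le hprob hk (ih (by omega))).trans (le_of_eq ?_)
    rw [epochRadius_sq, epochRadius_sq, pow_succ]
    ring

theorem IsEpochRGDRun.integrable_value
    (hprob : IsDuelProblem S f ρ α β c p r (epochGamma α β d (Metric.diam S) 0) wstar)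
    (h : IsEpochRGDRun P S f ρ α β c p (Metric.diam S) ε w₁ w x u o) {k : ℕ}
    (hk : k ≤ epochCount β (Metric.diam S) ε) : Integrable (fun ω => f (w k ω)) P := by
  have hβ := hprob.β_pos
  have heq : ∀ y ∈ S, queryValue S (epochGamma α β d (Metric.diam S) 0) f y = f y := fun y hy =>
    Set.indicator_of_mem (Metric.self_subset_cthickening S hy) f
  have hS := (h.measurable_and_mem hprob hk).2
  have := h.integrable_comp hprob hk hprob.measurable_queryValue
    (C := |f wstar| + β / 2 * Metric.diam S ^ 2) fun y hy => by
      rw [heq y hy]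
      have h1 := hprob.sub_le hy
      have h2 : f wstar ≤ f y := hprob.isMin hy
      have h3 : β / 2 * ‖y - wstar‖ ^ 2 ≤ β / 2 * Metric.diam S ^ 2 := by
        gcongr
        exact hprob.norm_sub_le_diam hy
      have h4 := abs_sub_abs_le_abs_sub (f y) (f wstar)
      rw [abs_of_nonneg (sub_nonneg.2 h2)] at h4
      linarith
  simpa only [heq _ (hS _)] using this

theorem IsEpochRGDRun.integral_value_sub_le
    (hprob : IsDuelProblem S f ρ α β c p r (epochGamma α β d (Metric.diam S) 0) wstar)
    (h : IsEpochRGDRun P S f ρ α β c p (Metric.diam S) ε w₁ w x u o) (hε : 0 < ε) :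
    ∫ ω, f (w (epochCount β (Metric.diam S) ε) ω) ∂P - f wstar ≤ ε := by
  have hβ := hprob.β_pos
  set K := epochCount β (Metric.diam S) ε with hK
  have hint := h.integrable_value hprob (k := K) le_rfl
  have hS := (h.measurable_and_mem hprob (k := K) le_rfl).2
  calc ∫ ω, f (w K ω) ∂P - f wstar = ∫ ω, (f (w K ω) - f wstar) ∂P := by
        rw [integral_sub hint (integrable_const _)]; simp
    _ ≤ ∫ ω, β / 2 * ‖w K ω - wstar‖ ^ 2 ∂P :=
        integral_mono (hint.sub (integrable_const _))
          ((h.integrable_norm_sq hprob (k := K) le_rfl).const_mul _) fun ω => hprob.sub_le (hS ω)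
    _ = β / 2 * ∫ ω, ‖w K ω - wstar‖ ^ 2 ∂P := integral_const_mul _ _
    _ ≤ β / 2 * ((3 / 4 : ℝ) ^ K * Metric.diam S ^ 2) := by
        rw [← epochRadius_sq]
        gcongr
        exact h.integral_norm_sq_le hprob le_rfl
    _ ≤ ε := mul_le_of_epochCount_le hβ hprob.diam_pos hε

end EpochRun

theorem mainTheorem2 (p β : ℝ) (hp : 1 ≤ p) (hβ : 0 < β) :
    ∃ C : ℝ, 0 < C ∧
      ∀ (d : ℕ) (_ : 1 ≤ d) (α c r : ℝ) (_ : 0 < α)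
        (ρ : ℝ → ℝ) (_ : IsAdmissibleTransfer ρ p r c)
        (S : Set (EuclideanSpace ℝ (Fin d)))
        (_ : Convex ℝ S) (_ : IsClosed S) (_ : Bornology.IsBounded S)
        (D : ℝ) (_ : D = Metric.diam S)
        (f : EuclideanSpace ℝ (Fin d) → ℝ)
        (_ : ∀ y ∈ Metric.cthickening (epochGamma α β d D 0) S, DifferentiableAt ℝ f y)
        (_ : IsStronglyConvexOn (Metric.cthickening (epochGamma α β d D 0) S) α f)
        (_ : IsSmoothOn (Metric.cthickening (epochGamma α β d D 0) S) β f)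
        (_ : ∀ y ∈ S, ∀ v, ‖v‖ ≤ epochGamma α β d D 0 → |f (y + v) - f (y - v)| ≤ r)
        (wstar : EuclideanSpace ℝ (Fin d)) (_ : wstar ∈ interior S) (_ : IsMinOn f S wstar)
        (ε : ℝ) (_ : 0 < ε),
        (epochQueries α β c p d D ε : ℝ) ≤ C / (epochB α β c p d ^ 2 * ε ^ (2 * p)) ∧
        ∀ (Ω : Type*) [MeasurableSpace Ω] (P : Measure Ω) [IsProbabilityMeasure P]
          (w₁ : EuclideanSpace ℝ (Fin d)) (w : ℕ → Ω → EuclideanSpace ℝ (Fin d))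
          (x u : ℕ → ℕ → Ω → EuclideanSpace ℝ (Fin d)) (o : ℕ → ℕ → Ω → ℝ),
          IsEpochRGDRun P S f ρ α β c p D ε w₁ w x u o →
            (∀ k ≤ epochCount β D ε,
              Integrable (fun ω => ‖w k ω - wstar‖ ^ 2) P ∧
              ∫ ω, ‖w k ω - wstar‖ ^ 2 ∂P ≤ (3 / 4 : ℝ) ^ k * D ^ 2) ∧
            (∀ k < epochCount β D ε,
              ∫ ω, ‖w (k + 1) ω - wstar‖ ^ 2 ∂P ≤
                3 / 4 * max (∫ ω, ‖w k ω - wstar‖ ^ 2 ∂P) (epochRadius D k ^ 2)) ∧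
            Integrable (fun ω => f (w (epochCount β D ε) ω)) P ∧
            ∫ ω, f (w (epochCount β D ε) ω) ∂P - f wstar ≤ ε := by
  refine ⟨20 * (β / 2) ^ (2 * p), by positivity, ?_⟩
  intro d hd α c r hα ρ hρ S hS hcl hbd D hD f hdiff hsc hsm hgap wstar hws hmin ε hε
  subst hD
  have hprob : IsDuelProblem S f ρ α β c p r (epochGamma α β d (Metric.diam S) 0) wstar :=
    ⟨hd, hα, hβ, hρ, hS, hcl, hbd, hdiff, hsc, hsm, hgap, hws, hmin⟩
  refine ⟨hprob.epochQueries_le hε, ?_⟩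
  intro Ω _ P _ w₁ w x u o hrun
  refine ⟨fun k hk => ⟨hrun.integrable_norm_sq hprob hk, ?_⟩, fun k hk => ?_,
    hrun.integrable_value hprob le_rfl, hrun.integral_value_sub_le hprob hε⟩
  · rw [← epochRadius_sq]
    exact hrun.integral_norm_sq_le hprob hk
  · refine (hrun.integral_norm_sq_succ_le hprob hk (hrun.integral_norm_sq_le hprob hk.le)).trans ?_
    gcongr
    exact le_max_right _ _
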